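/- **Graphs.** A graph $\Gamma$ has a set $V_\Gamma$ of vertices and a set $E_\Gamma$ of directed edges $e$ with source $s(e)$, target $t(e)$ and weight $w(e)\in\mathbb Z_{>0}$; loops and multiple edges are allowed. It is undirected if there is an involution $e\mapsto e'$ of $E_\Gamma$ with $s(e)=t(e')$, $t(e)=s(e')$, $w(e)=w(e')$. A walk is a sequence of consecutive edges (possibly empty, at a vertex), and its weight is the sum of the weights of its edges. A cycle is a non-trivial closed walk $e_1\cdots e_\ell$ with $t(e_1),\dots,t(e_\ell)$ distinct. $d_\Gamma(x,y)\in\mathbb Z_{\ge0}\cup\{\infty\}$ is the least weight of a walk from $x$ to $y$, and $\Gamma$ is strongly connected if $d_\Gamma$ is always finite. For $x_0\in V_\Gamma$ put $s_i=\#\{y: d_\Gamma(x_0,y)=i\}$, $b_i=\#\{y: d_\Gamma(x_0,y)\le i\}$, $G_s(t)=\sum_{i\ge0}s_it^i$ and $G_b(t)=\sum_{i\ge0}b_it^i$. **Periodic graphs.** Let $n\ge1$. An $n$-dimensional periodic graph $(\Gamma,L)$ is a graph $\Gamma$ with a free abelian group $L\simeq\mathbb Z^n$ acting freely on $V_\Gamma$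 and on $E_\Gamma$, with finitely many orbits on each, and preserving sources, targets and weights. Put $L_{\mathbb R}=L\otimes_{\mathbb Z}\mathbb R$. A periodic realization is a map $\Phi:V_\Gamma\to L_{\mathbb R}$ with $\Phi(u+x)=u+\Phi(x)$ for $u\in L$, $x\in V_\Gamma$. For a cycle $q$ of the quotient graph $\Gamma/L$ let $\mu(q)\in L$ be the element $t(p)-s(p)$, where $p$ is any lift of $q$ to a walk in $\Gamma$. The growth polytope is $P_\Gamma=\operatorname{conv}(\{0\}\cup\{\mu(q)/w(q): q\text{ a cycle of }\Gamma/L\})\subset L_{\mathbb R}$. $V(\cdot)$ denotes the set of vertices of a polytope. A triangulation of a $d$-dimensional polytope $\sigma$ is a finite set of $d$-simplices with union $\sigma$, such that $\Delta_1\cap\Delta_2$ is a face of $\Delta_1$ for any two members $\Delta_1,\Delta_2$. **Well-arranged.** Let $(\Gamma,L)$ be a strongly connected, undirected $n$-dimensional periodic graph, $\Phi$ a periodic realization and $x_0\in V_\Gamma$. Call integers $d_v>0$ ($v\in V(P_\Gamma)$) and triangulations $T_\sigma$ of the facets $\sigma$ of $P_\Gamma$ an arrangement for $(\Gamma,\Phi,x_0)$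 if 1. $V(\Delta)\subset V(\sigma)$ for every facet $\sigma$ and every $\Delta\in T_\sigma$; 2. $d_vv\in L$ for every $v\in V(P_\Gamma)$; 3. for every facet $\sigma$, every $\Delta\in T_\sigma$ and every $V'\subset V(\Delta)$, with $z=\bigl(\sum_{v\in V'}d_vv\bigr)+x_0$, one has $d_\Gamma(x_0,y)+d_\Gamma(y,z)=\sum_{v\in V'}d_v$ for every $y\in V_\Gamma$ with $\Phi(y)-\Phi(x_0)\in\sum_{v\in V'}[0,d_v)v$. The triple $(\Gamma,\Phi,x_0)$ is well-arranged if it has an arrangement. A quasi-polynomial is a function $f:\mathbb Z\to\mathbb C$ for which there are $N\ge1$ and $Q_0,\dots,Q_{N-1}\in\mathbb C[x]$ with $f(m)=Q_i(m)$ whenever $m\equiv i\pmod N$. **Theorem.** Let $(\Gamma,L)$ be a strongly connected, undirected $n$-dimensional periodic graph, $\Phi$ a periodic realization and $x_0\in V_\Gamma$, and suppose that $(\Gamma,\Phi,x_0)$ is well-arranged. Then: 1. The function $i\mapsto b_i$ agrees with a quasi-polynomial for all $i\ge0$. 2. For every arrangement $(d_v)$, $(T_\sigma)$ for $(\Gamma,\Phi,x_0)$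 there are polynomials $Q_1,Q_2\in\mathbb Q[t]$ such that $G_s(t)=Q_1(t)/Q_2(t)$, $\deg Q_1\le\deg Q_2$, and $Q_2$ is a least common multiple of the polynomials $\prod_{v\in V(\Delta)}(1-t^{d_v})$, where $\sigma$ runs over the facets of $P_\Gamma$ and $\Delta$ over $T_\sigma$. 3. $G_b$ and $G_s$ are expansions of rational functions, which satisfy $$G_b(1/t)=(-1)^{n+1}\,t\,G_b(t),\qquad G_s(1/t)=(-1)^nG_s(t).$$ Moreover, the sequence $s_i$ agrees with a quasi-polynomial for all $i\ge1$, and if $f_b$ and $f_s$ denote the quasi-polynomials which agree with $(b_i)$ and $(s_i)$ for all large $i$, then $f_b(-i)=(-1)^nf_b(i-1)$ for all $i\in\mathbb Z$ and $f_s(-i)=(-1)^{n+1}f_s(i)$ for all $i\in\mathbb Z\setminus\{0\}$. -/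

import Mathlib

open scoped TensorProduct Polynomial PowerSeries

noncomputable section

namespace PeriodicGrowth

/-! ### Directed weighted graphs (loops and multiple edges allowed) -/

/-- A directed graph with positive integer weights on its edges. -/
structure WGraph (V E : Type*) where
  src : E → V
  tgt : E → V
  wt : E → ℕ
  wt_pos : ∀ e, 0 < wt e

namespace WGraph

variable {V E : Type*} (Γ : WGraph V E)

/-- The sequence `p` of edges is a walk from `x` to `y`;
the empty sequence is the trivial walk at each vertex. -/
def IsWalk : V → List E → V → Prop
  | x, [], y => x = y
  | x, e :: p, y => Γ.src e = x ∧ IsWalk (Γ.tgt e) p y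

/-- The weight of a walk. -/
def weight (p : List E) : ℕ := (p.map Γ.wt).sum

/-- A cycle: a nontrivial closed walk `e₁ ⋯ e_ℓ` with `t(e₁), …, t(e_ℓ)` distinct. -/
def IsCycle (p : List E) : Prop :=
  p ≠ [] ∧ (∃ x, Γ.IsWalk x p x) ∧ (p.map Γ.tgt).Nodup

/-- The smallest weight of a walk from `x` to `y`, and `⊤` if there is no such walk. -/
def dist (x y : V) : ℕ∞ := ⨅ (p : List E) (_ : Γ.IsWalk x p y), (Γ.weight p : ℕ∞)

def StronglyConnected : Prop := ∀ x y, Γ.dist x y < ⊤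

def Undirected : Prop :=
  ∃ r : E → E, Function.Involutive r ∧
    ∀ e, Γ.src e = Γ.tgt (r e) ∧ Γ.tgt e = Γ.src (r e) ∧ Γ.wt e = Γ.wt (r e)

/-- The growth sequence `s_i`. -/
def sphereCard (x₀ : V) (i : ℕ) : ℕ := {y | Γ.dist x₀ y = i}.ncard

/-- The cumulative growth sequence `b_i`. -/
def ballCard (x₀ : V) (i : ℕ) : ℕ := {y | Γ.dist x₀ y ≤ i}.ncard

/-- `G_s(t) = ∑ s_i t^i`. -/
def sphereSeries (x₀ : V) : ℚ⟦X⟧ := PowerSeries.mk fun i => (Γ.sphereCard x₀ i : ℚ)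

/-- `G_b(t) = ∑ b_i t^i`. -/
def ballSeries (x₀ : V) : ℚ⟦X⟧ := PowerSeries.mk fun i => (Γ.ballCard x₀ i : ℚ)

end WGraph

/-! ### Periodic graphs -/

/-- A graph with a free action of `L` on vertices and edges which has finitely many orbits and
preserves sources, targets and weights. That `L` is free abelian of positive finite rank is a
hypothesis on `L`. -/
structure PeriodicGraph (L V E : Type*) [AddCommGroup L] [AddAction L V] [AddAction L E]
    extends WGraph V E where
  free_vertex : ∀ (u : L) (x : V), u +ᵥ x = x → u = 0
  free_edge : ∀ (u : L) (e : E), u +ᵥ e = e → u = 0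
  finite_vertex : Finite (AddAction.orbitRel.Quotient L V)
  finite_edge : Finite (AddAction.orbitRel.Quotient L E)
  src_vadd : ∀ (u : L) (e : E), src (u +ᵥ e) = u +ᵥ src e
  tgt_vadd : ∀ (u : L) (e : E), tgt (u +ᵥ e) = u +ᵥ tgt e
  wt_vadd : ∀ (u : L) (e : E), wt (u +ᵥ e) = wt e

/-- The real vector space `L_ℝ = L ⊗ ℝ`. -/
abbrev RealSpan (L : Type*) [AddCommGroup L] : Type _ := ℝ ⊗[ℤ] L

/-- The natural map `L → L_ℝ`, which is injective for `L` free. -/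
def toReal {L : Type*} [AddCommGroup L] (u : L) : RealSpan L := (1 : ℝ) ⊗ₜ[ℤ] u

namespace PeriodicGraph

variable {L V E : Type*} [AddCommGroup L] [AddAction L V] [AddAction L E]
  (Γ : PeriodicGraph L V E)

/-- The quotient graph `Γ / L`. -/
def quotientGraph :
    WGraph (AddAction.orbitRel.Quotient L V) (AddAction.orbitRel.Quotient L E) where
  src := Quotient.map' Γ.src (by
    rintro _ b ⟨u, rfl⟩
    exact ⟨u, (Γ.src_vadd u b).symm⟩)
  tgt := Quotient.map' Γ.tgt (by
    rintro _ b ⟨u, rfl⟩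
    exact ⟨u, (Γ.tgt_vadd u b).symm⟩)
  wt := fun e => Quotient.liftOn' e Γ.wt (by
    rintro _ b ⟨u, rfl⟩
    exact Γ.wt_vadd u b)
  wt_pos := fun e => Quotient.inductionOn' e Γ.wt_pos

/-- `μ(⟨q⟩) = u` for a closed walk `q` of `Γ / L`: some (equivalently, every) lift `p` of `q` to `Γ`
has `vec(p) = t(p) - s(p) = u`. -/
def HasVec (q : List (AddAction.orbitRel.Quotient L E)) (u : L) : Prop :=
  ∃ (p : List E) (x : V), p.map Quotient.mk'' = q ∧ Γ.IsWalk x p (u +ᵥ x)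

/-- The image of the normalization map `ν(q) = μ(⟨q⟩) / w(q)` on the cycles `q` of `Γ / L`. -/
def normalizedCycles : Set (RealSpan L) :=
  {a | ∃ q u, Γ.quotientGraph.IsCycle q ∧ Γ.HasVec q u ∧
    a = ((Γ.quotientGraph.weight q : ℝ))⁻¹ • toReal u}

/-- The growth polytope `P_Γ = conv (Im ν ∪ {0})`. -/
def growthPolytope : Set (RealSpan L) := convexHull ℝ (Γ.normalizedCycles ∪ {0})

/-- A periodic realization of the vertices in `L_ℝ`. -/
def IsRealization (_Γ : PeriodicGraph L V E) (Φ : V → RealSpan L) : Prop :=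
  ∀ (u : L) (x : V), Φ (u +ᵥ x) = toReal u + Φ x

end PeriodicGraph

/-! ### Polytopes and triangulations -/

section Polytopes

variable {W : Type*} [AddCommGroup W] [Module ℝ W]

/-- `F` is a face of the polytope `P` (both `P` and `∅` are faces). -/
def IsFace (P F : Set W) : Prop :=
  ∃ (l : W →ₗ[ℝ] ℝ) (c : ℝ), (∀ x ∈ P, l x ≤ c) ∧ F = {x ∈ P | l x = c}

/-- The dimension of (the affine hull of) a nonempty set. -/
def affDim (P : Set W) : ℕ := Module.finrank ℝ (vectorSpan ℝ P)

/-- `F` is a facet of the polytope `P`. -/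
def IsFacet (P F : Set W) : Prop := IsFace P F ∧ F.Nonempty ∧ affDim F + 1 = affDim P

/-- `T` is a triangulation of the polytope `σ`; a simplex is given by its set of vertices. -/
structure IsTriangulation (σ : Set W) (T : Finset (Finset W)) : Prop where
  card_eq : ∀ Δ ∈ T, Δ.card = affDim σ + 1
  indep : ∀ Δ ∈ T, AffineIndependent ℝ (fun v : Δ => (v : W))
  union_eq : σ = ⋃ Δ ∈ T, convexHull ℝ (Δ : Set W)
  inter_face : ∀ Δ₁ ∈ T, ∀ Δ₂ ∈ T,
    IsFace (convexHull ℝ (Δ₁ : Set W)) (convexHull ℝ (Δ₁ : Set W) ∩ convexHull ℝ (Δ₂ : Set W))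

end Polytopes

/-! ### Well-arranged triples -/

section WellArranged

variable {L V E : Type*} [AddCommGroup L] [AddAction L V] [AddAction L E]

/-- The integers `d_v` (`v` a vertex of `P_Γ`) and the triangulations `T_σ` (`σ` a facet of `P_Γ`)
witness that `(Γ, Φ, x₀)` is well-arranged. The values of `d` and `T` elsewhere are irrelevant. -/
structure IsArrangement (Γ : PeriodicGraph L V E) (Φ : V → RealSpan L) (x₀ : V)
    (d : RealSpan L → ℕ) (T : Set (RealSpan L) → Finset (Finset (RealSpan L))) : Prop where
  pos : ∀ v ∈ Γ.growthPolytope.extremePoints ℝ, 0 < d v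
  triangulation : ∀ σ, IsFacet Γ.growthPolytope σ → IsTriangulation σ (T σ)
  vertices : ∀ σ, IsFacet Γ.growthPolytope σ → ∀ Δ ∈ T σ,
    (Δ : Set (RealSpan L)) ⊆ σ.extremePoints ℝ
  integral : ∀ v ∈ Γ.growthPolytope.extremePoints ℝ, ∃ u : L, toReal u = (d v : ℝ) • v
  dist_add : ∀ σ, IsFacet Γ.growthPolytope σ → ∀ Δ ∈ T σ, ∀ V' ⊆ Δ,
    ∀ u : L, toReal u = ∑ v ∈ V', (d v : ℝ) • v →
    ∀ y : V, (∃ c : RealSpan L → ℝ, (∀ v ∈ V', 0 ≤ c v ∧ c v < d v) ∧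
        Φ y - Φ x₀ = ∑ v ∈ V', c v • v) →
      Γ.dist x₀ y + Γ.dist y (u +ᵥ x₀) = ((∑ v ∈ V', d v : ℕ) : ℕ∞)

/-- `(Γ, Φ, x₀)` is well-arranged. -/
def WellArranged (Γ : PeriodicGraph L V E) (Φ : V → RealSpan L) (x₀ : V) : Prop :=
  ∃ d T, IsArrangement Γ Φ x₀ d T

/-- The polynomials `∏_{v ∈ V(Δ)} (1 - t^{d_v})`, for the simplices `Δ` of the triangulations
`T_σ` of the facets `σ` of `P_Γ`. -/
def simplexPolynomials (Γ : PeriodicGraph L V E)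
    (d : RealSpan L → ℕ) (T : Set (RealSpan L) → Finset (Finset (RealSpan L))) : Set ℚ[X] :=
  {f | ∃ σ, IsFacet Γ.growthPolytope σ ∧ ∃ Δ ∈ T σ,
    f = ∏ v ∈ Δ, (1 - (Polynomial.X : ℚ[X]) ^ d v)}

end WellArranged

/-! ### Quasi-polynomials and rational functions -/

def IsQuasiPolynomial (f : ℤ → ℂ) : Prop :=
  ∃ N : ℕ, 0 < N ∧ ∃ Q : Fin N → ℂ[X],
    ∀ (i : Fin N) (m : ℤ), m ≡ (i : ℤ) [ZMOD N] → f m = (Q i).eval (m : ℂ)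

/-- `g` is a quasi-polynomial on `i ≥ m`. -/
def IsQuasiPolynomialOn (g : ℕ → ℕ) (m : ℕ) : Prop :=
  ∃ f, IsQuasiPolynomial f ∧ ∀ i : ℕ, m ≤ i → (g i : ℂ) = f i

/-- `f` is the quasi-polynomial corresponding to the sequence `g`: they agree at all large `i`. -/
def IsQuasiPolynomialOf (f : ℤ → ℂ) (g : ℕ → ℕ) : Prop :=
  IsQuasiPolynomial f ∧ ∃ M : ℕ, ∀ i : ℕ, M < i → (g i : ℂ) = f i

/-- `Q` is a least common multiple of the polynomials in `S` (unique up to a nonzero constant). -/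
def IsLCM (S : Set ℚ[X]) (Q : ℚ[X]) : Prop :=
  (∀ f ∈ S, f ∣ Q) ∧ ∀ R : ℚ[X], (∀ f ∈ S, f ∣ R) → Q ∣ R

/-- The power series `G` is the expansion at `0` of the rational function `R`. -/
def IsExpansion (R : RatFunc ℚ) (G : ℚ⟦X⟧) : Prop :=
  (R : LaurentSeries ℚ) = (G : LaurentSeries ℚ)

/-- The rational function `R(1/t)`. -/
def atInv (R : RatFunc ℚ) : RatFunc ℚ := R.eval RatFunc.C (RatFunc.X)⁻¹

end PeriodicGrowth

end

open PeriodicGrowth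

/-!
A generic vector `ξ` splits `L_ℝ` into half-open simplicial cones, one over each simplex of the
triangulated facets: each point belongs to the cone whose interior it enters when pushed slightly
in the direction `ξ`. Well-arrangedness makes the distance from `x₀` additive under translation by
`d_v v` inside such a cone, so that the vertices whose position lies in the cone over `Δ` have the
generating function `N_Δ(t) / ∏ (1 - t ^ d_v)`, where `N_Δ` counts the vertices in a half-open box,
and `G_s` is the sum of these.

A vertex in the box lies on a geodesic from `x₀` to the opposite corner `x₀ + ∑ d_v v`. Translating
that corner to `x₀` and using that distances are symmetric, one gets the box of the negated
half-open cone with `N_Δ` reflected at `∑ d_v`. Negating a cone interchanges `ξ` and `-ξ`, so the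
reflected numerators again sum to `G_s`, now by the decomposition for `-ξ`; as the denominators
satisfy `Q(1/t) = (-1) ^ n t ^ (-deg Q) Q(t)`, this is the functional equation of `G_s`. Written
over a common denominator `(1 - t ^ K) ^ n`, respectively `(1 - t ^ K) ^ (n + 1)` for `G_b`, the
same symmetry becomes the reciprocity of the quasi-polynomials.
-/

noncomputable section

namespace PeriodicGrowth

/-! ### Walks and distances -/

namespace WGraph

variable {V E : Type*} {Γ : WGraph V E}

theorem isWalk_append {p q : List E} {x z : V} :
    Γ.IsWalk x (p ++ q) z ↔ ∃ y, Γ.IsWalk x p y ∧ Γ.IsWalk y q z := by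
  induction p generalizing x with
  | nil => simp [IsWalk]
  | cons e p ih => simp [IsWalk, ih, and_assoc]

theorem isWalk_concat {p : List E} {e : E} {x z : V} :
    Γ.IsWalk x (p ++ [e]) z ↔ Γ.IsWalk x p (Γ.src e) ∧ Γ.tgt e = z := by
  simp [isWalk_append, IsWalk]

theorem weight_append (p q : List E) : Γ.weight (p ++ q) = Γ.weight p + Γ.weight q := by
  simp [weight]

theorem length_le_weight (p : List E) : p.length ≤ Γ.weight p := by
  simpa [weight] using List.length_le_sum_of_one_le (p.map Γ.wt)
    (List.forall_mem_map.2 fun e _ => Γ.wt_pos e)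

theorem IsCycle.weight_pos {q : List E} (hq : Γ.IsCycle q) : 0 < Γ.weight q :=
  (List.length_pos_iff.2 hq.1).trans_le (length_le_weight q)

/-- The distance as a natural number. It has the junk value `0` if there is no walk. -/
def natDist (Γ : WGraph V E) (x y : V) : ℕ := sInf {m | ∃ p, Γ.IsWalk x p y ∧ Γ.weight p = m}

theorem natDist_le_weight {x y : V} {p : List E} (hp : Γ.IsWalk x p y) :
    Γ.natDist x y ≤ Γ.weight p :=
  Nat.sInf_le ⟨p, hp, rfl⟩

theorem natDist_self (x : V) : Γ.natDist x x = 0 :=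
  Nat.le_zero.1 (natDist_le_weight (p := []) rfl)

namespace StronglyConnected

theorem exists_isWalk (h : Γ.StronglyConnected) (x y : V) : ∃ p, Γ.IsWalk x p y := by
  by_contra! hp
  simpa [dist, hp] using h x y

theorem exists_weight_eq (h : Γ.StronglyConnected) (x y : V) :
    ∃ p, Γ.IsWalk x p y ∧ Γ.weight p = Γ.natDist x y := by
  obtain ⟨p, hp⟩ := h.exists_isWalk x y
  exact Nat.sInf_mem (s := {m | ∃ p, Γ.IsWalk x p y ∧ Γ.weight p = m}) ⟨_, p, hp, rfl⟩

theorem dist_eq (h : Γ.StronglyConnected) (x y : V) : Γ.dist x y = Γ.natDist x y := by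
  apply le_antisymm
  · obtain ⟨p, hp, hw⟩ := h.exists_weight_eq x y
    exact hw ▸ iInf₂_le p hp
  · exact le_iInf₂ fun p hp => Nat.cast_le.2 (natDist_le_weight hp)

theorem natDist_triangle (h : Γ.StronglyConnected) (x y z : V) :
    Γ.natDist x z ≤ Γ.natDist x y + Γ.natDist y z := by
  obtain ⟨p, hp, hpw⟩ := h.exists_weight_eq x y
  obtain ⟨q, hq, hqw⟩ := h.exists_weight_eq y z
  rw [← hpw, ← hqw, ← weight_append]
  exact natDist_le_weight (isWalk_append.2 ⟨y, hp, hq⟩)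

end StronglyConnected

theorem IsWalk.reverse {r : E → E} (hsrc : ∀ e, Γ.src (r e) = Γ.tgt e)
    (htgt : ∀ e, Γ.tgt (r e) = Γ.src e) {x y : V} {p : List E} (hp : Γ.IsWalk x p y) :
    Γ.IsWalk y (p.map r).reverse x := by
  induction p generalizing x with
  | nil => exact hp.symm
  | cons e p ih =>
    rw [List.map_cons, List.reverse_cons, isWalk_concat, hsrc, htgt]
    exact ⟨ih hp.2, hp.1⟩

theorem StronglyConnected.natDist_comm (h : Γ.StronglyConnected) (hu : Γ.Undirected) (x y : V) :
    Γ.natDist x y = Γ.natDist y x := by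
  obtain ⟨r, -, hr⟩ := hu
  suffices key : ∀ x y, Γ.natDist y x ≤ Γ.natDist x y from le_antisymm (key y x) (key x y)
  intro x y
  obtain ⟨p, hp, hpw⟩ := h.exists_weight_eq x y
  have hwt : Γ.wt ∘ r = Γ.wt := funext fun e => (hr e).2.2.symm
  calc Γ.natDist y x ≤ Γ.weight (p.map r).reverse :=
        natDist_le_weight (hp.reverse (fun e => (hr e).2.1.symm) fun e => (hr e).1.symm)
    _ = Γ.weight p := by simp [weight, hwt]
    _ = Γ.natDist x y := hpw

theorem finite_isWalk_length (hfin : ∀ x, {e | Γ.src e = x}.Finite) (k : ℕ) (x : V) :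
    {y | ∃ p : List E, p.length = k ∧ Γ.IsWalk x p y}.Finite := by
  induction k generalizing x with
  | zero =>
    refine (Set.finite_singleton x).subset ?_
    rintro y ⟨p, hp, hw⟩
    obtain rfl := List.length_eq_zero_iff.1 hp
    exact hw.symm
  | succ k ih =>
    refine ((hfin x).biUnion fun e _ => ih (Γ.tgt e)).subset ?_
    rintro y ⟨_ | ⟨e, p⟩, hp, hw⟩
    · simp at hp
    · exact Set.mem_biUnion (x := e) hw.1 ⟨p, Nat.succ_injective hp, hw.2⟩

theorem StronglyConnected.finite_ball (h : Γ.StronglyConnected)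
    (hfin : ∀ x, {e | Γ.src e = x}.Finite) (x : V) (i : ℕ) : {y | Γ.natDist x y ≤ i}.Finite := by
  refine ((Set.finite_Iic i).biUnion fun k _ => finite_isWalk_length hfin k x).subset ?_
  intro y hy
  obtain ⟨p, hp, hw⟩ := h.exists_weight_eq x y
  exact Set.mem_biUnion (x := p.length) ((length_le_weight p).trans (hw.trans_le hy)) ⟨p, rfl, hp⟩

end WGraph

/-! ### Closed walks of the quotient graph -/

section ToReal

variable {L : Type*} [AddCommGroup L]

/-- The natural map `L → L_ℝ` as an additive map. -/
def toRealHom (L : Type*) [AddCommGroup L] : L →+ RealSpan L where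
  toFun := toReal
  map_zero' := TensorProduct.tmul_zero _ _
  map_add' := TensorProduct.tmul_add _

theorem toReal_zero : toReal (0 : L) = 0 := map_zero (toRealHom L)

theorem toReal_add (u v : L) : toReal (u + v) = toReal u + toReal v := map_add (toRealHom L) u v

theorem toReal_neg (u : L) : toReal (-u) = -toReal u := map_neg (toRealHom L) u

theorem toReal_nsmul (k : ℕ) (u : L) : toReal (k • u) = (k : ℝ) • toReal u :=
  (map_nsmul (toRealHom L) k u).trans (Nat.cast_smul_eq_nsmul ℝ k _).symm

theorem toReal_sum {ι : Type*} (s : Finset ι) (u : ι → L) :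
    toReal (∑ i ∈ s, u i) = ∑ i ∈ s, toReal (u i) := map_sum (toRealHom L) u s

theorem smul_toReal (r : ℝ) (u : L) : r • toReal u = r ⊗ₜ[ℤ] u := by
  rw [toReal, TensorProduct.smul_tmul', smul_eq_mul, mul_one]

end ToReal

theorem exists_append_of_not_nodup_map {α β : Type*} (f : α → β) (p : List α)
    (h : ¬ (p.map f).Nodup) :
    ∃ p₁ e p₂ e' p₃, p = p₁ ++ e :: (p₂ ++ e' :: p₃) ∧ f e = f e' := by
  induction p with
  | nil => simp at h
  | cons a p ih =>
    by_cases hp : (p.map f).Nodup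
    · have ha : f a ∈ p.map f := by
        simpa only [List.map_cons, List.nodup_cons, hp, and_true, not_not] using h
      obtain ⟨b, hb, hab⟩ := List.mem_map.1 ha
      obtain ⟨s, t, rfl⟩ := List.append_of_mem hb
      exact ⟨[], a, s, b, t, rfl, hab.symm⟩
    · obtain ⟨p₁, e, p₂, e', p₃, rfl, hee⟩ := ih hp
      exact ⟨a :: p₁, e, p₂, e', p₃, rfl, hee⟩

theorem orbitRel_mk_eq_mk_iff {L X : Type*} [AddGroup L] [AddAction L X] {a b : X} :
    (Quotient.mk'' a : AddAction.orbitRel.Quotient L X) = Quotient.mk'' b ↔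
      ∃ u : L, u +ᵥ b = a :=
  Quotient.eq''

namespace PeriodicGraph

variable {L V E : Type*} [AddCommGroup L] [AddAction L V] [AddAction L E]
  {Γ : PeriodicGraph L V E}

theorem vadd_injective (Γ : PeriodicGraph L V E) (x : V) :
    Function.Injective fun u : L => u +ᵥ x := by
  intro u v (h : u +ᵥ x = v +ᵥ x)
  exact (neg_add_eq_zero.1 (Γ.free_vertex (-v + u) x (by rw [add_vadd, h, neg_vadd_vadd]))).symm

theorem IsWalk.vadd {p : List E} {x y : V} (h : Γ.IsWalk x p y) (u : L) :
    Γ.IsWalk (u +ᵥ x) (p.map (u +ᵥ ·)) (u +ᵥ y) := by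
  induction p generalizing x with
  | nil => exact congrArg (u +ᵥ ·) h
  | cons e p ih => exact ⟨by rw [Γ.src_vadd, h.1], by rw [Γ.tgt_vadd]; exact ih h.2⟩

theorem weight_vadd (p : List E) (u : L) : Γ.weight (p.map (u +ᵥ ·)) = Γ.weight p := by
  simp [WGraph.weight, Function.comp_def, Γ.wt_vadd]

theorem natDist_vadd (hconn : Γ.StronglyConnected) (u : L) (x y : V) :
    Γ.natDist (u +ᵥ x) (u +ᵥ y) = Γ.natDist x y := by
  have key (u : L) (x y) : Γ.natDist (u +ᵥ x) (u +ᵥ y) ≤ Γ.natDist x y := by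
    obtain ⟨p, hp, hw⟩ := hconn.exists_weight_eq x y
    rw [← hw, ← weight_vadd p u]
    exact WGraph.natDist_le_weight (IsWalk.vadd hp u)
  exact le_antisymm (key _ _ _) (by simpa using key (-u) (u +ᵥ x) (u +ᵥ y))

theorem finite_src (Γ : PeriodicGraph L V E) (x : V) : {e | Γ.src e = x}.Finite := by
  have := Γ.finite_edge
  refine Set.Finite.of_finite_image (Set.toFinite ((Quotient.mk'' :
    E → AddAction.orbitRel.Quotient L E) '' _)) fun e he e' he' h => ?_
  obtain ⟨u, rfl⟩ := orbitRel_mk_eq_mk_iff.1 h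
  have hu : u +ᵥ Γ.src e' = Γ.src e' := by rw [← Γ.src_vadd, he, he']
  rw [Γ.free_vertex _ _ hu, zero_vadd]

theorem finite_ball (hconn : Γ.StronglyConnected) (x : V) (i : ℕ) :
    {y | Γ.natDist x y ≤ i}.Finite :=
  hconn.finite_ball Γ.finite_src x i

theorem quotientGraph_isWalk {p : List E} {x y : V} (h : Γ.IsWalk x p y) :
    Γ.quotientGraph.IsWalk (Quotient.mk'' x) (p.map Quotient.mk'') (Quotient.mk'' y) := by
  induction p generalizing x with
  | nil => exact congrArg _ h
  | cons e p ih => exact ⟨congrArg Quotient.mk'' h.1, ih h.2⟩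

theorem quotientGraph_weight (p : List E) :
    Γ.quotientGraph.weight (p.map Quotient.mk'') = Γ.weight p := by
  simp only [WGraph.weight, List.map_map]
  rfl

theorem quotientGraph_isCycle {p : List E} {x : V} {u : L} (hp : Γ.IsWalk x p (u +ᵥ x))
    (hne : p ≠ []) (hnd : (p.map fun e =>
      (Quotient.mk'' (Γ.tgt e) : AddAction.orbitRel.Quotient L V)).Nodup) :
    Γ.quotientGraph.IsCycle (p.map Quotient.mk'') := by
  refine ⟨by simpa using hne, ⟨Quotient.mk'' x, ?_⟩, by rw [List.map_map]; exact hnd⟩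
  have hx : (Quotient.mk'' (u +ᵥ x) : AddAction.orbitRel.Quotient L V) = Quotient.mk'' x :=
    orbitRel_mk_eq_mk_iff.2 ⟨u, rfl⟩
  simpa only [hx] using quotientGraph_isWalk hp

/-- The pairs `(μ(q), w(q))` for the cycles `q` of `Γ / L`. -/
def cycleVectors (Γ : PeriodicGraph L V E) : Set (L × ℕ) :=
  {a | ∃ q, Γ.quotientGraph.IsCycle q ∧ Γ.HasVec q a.1 ∧ a.2 = Γ.quotientGraph.weight q}

theorem exists_excision {p : List E} {x : V} {u : L} (hp : Γ.IsWalk x p (u +ᵥ x))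
    (hnd : ¬ (p.map fun e =>
      (Quotient.mk'' (Γ.tgt e) : AddAction.orbitRel.Quotient L V)).Nodup) :
    ∃ p₁ p₂ y g, Γ.IsWalk y p₁ (g +ᵥ y) ∧ Γ.IsWalk x p₂ ((-g + u) +ᵥ x) ∧
      p₁.length < p.length ∧ p₂.length < p.length ∧ Γ.weight p₁ + Γ.weight p₂ = Γ.weight p := by
  obtain ⟨p₁, e, p₂, e', p₃, rfl, hee⟩ := exists_append_of_not_nodup_map _ _ hnd
  obtain ⟨g, hg⟩ := orbitRel_mk_eq_mk_iff.1 hee.symm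
  rw [show p₁ ++ e :: (p₂ ++ e' :: p₃) = (p₁ ++ [e]) ++ ((p₂ ++ [e']) ++ p₃) by simp] at hp ⊢
  obtain ⟨y, h₁, h₂₃⟩ := WGraph.isWalk_append.1 hp
  obtain ⟨z, h₂, h₃⟩ := WGraph.isWalk_append.1 h₂₃
  obtain rfl := (WGraph.isWalk_concat.1 h₁).2
  obtain rfl : g +ᵥ Γ.tgt e = z := hg.trans (WGraph.isWalk_concat.1 h₂).2
  refine ⟨p₂ ++ [e'], (p₁ ++ [e]) ++ p₃.map (-g +ᵥ ·), _, g, h₂,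
    WGraph.isWalk_append.2 ⟨_, h₁, ?_⟩, by simp; lia, by simp, ?_⟩
  · simpa only [neg_vadd_vadd, add_vadd] using IsWalk.vadd h₃ (-g)
  · simp only [WGraph.weight_append, weight_vadd]
    lia

theorem mem_closure_cycleVectors {p : List E} {x : V} {u : L} (hp : Γ.IsWalk x p (u +ᵥ x)) :
    (u, Γ.weight p) ∈ AddSubmonoid.closure Γ.cycleVectors := by
  induction hk : p.length using Nat.strong_induction_on generalizing p x u with
  | _ k ih =>
  subst hk
  obtain rfl | hne := eq_or_ne p []
  · obtain rfl : u = 0 := Γ.free_vertex _ _ (Eq.symm hp)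
    exact zero_mem _
  by_cases hnd : (p.map fun e => (Quotient.mk'' (Γ.tgt e) :
      AddAction.orbitRel.Quotient L V)).Nodup
  · exact AddSubmonoid.subset_closure
      ⟨_, quotientGraph_isCycle hp hne hnd, ⟨p, x, rfl, hp⟩, (quotientGraph_weight p).symm⟩
  · obtain ⟨p₁, p₂, y, g, h₁, h₂, hlt₁, hlt₂, hw⟩ := exists_excision hp hnd
    have := add_mem (ih _ hlt₁ h₁ rfl) (ih _ hlt₂ h₂ rfl)
    rwa [Prod.mk_add_mk, hw, add_neg_cancel_left] at this

theorem map_toReal_le_weight (l : RealSpan L →ₗ[ℝ] ℝ) (hl : ∀ a ∈ Γ.normalizedCycles, l a ≤ 1)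
    {p : List E} {x : V} {u : L} (hp : Γ.IsWalk x p (u +ᵥ x)) : l (toReal u) ≤ Γ.weight p := by
  refine AddSubmonoid.closure_induction (motive := fun a _ => l (toReal a.1) ≤ a.2) ?_ ?_ ?_
    (mem_closure_cycleVectors hp)
  · rintro ⟨u, _⟩ ⟨q, hq, hu, rfl⟩
    have h := hl _ ⟨q, u, hq, hu, rfl⟩
    rwa [map_smul, smul_eq_mul, inv_mul_le_iff₀ (Nat.cast_pos.2 hq.weight_pos), mul_one] at h
  · simp [toReal_zero]
  · intro a b _ _ ha hb
    simpa [toReal_add] using add_le_add ha hb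

theorem map_toReal_le_natDist (hconn : Γ.StronglyConnected) (l : RealSpan L →ₗ[ℝ] ℝ)
    (hl : ∀ a ∈ Γ.normalizedCycles, l a ≤ 1) (x : V) (u : L) :
    l (toReal u) ≤ Γ.natDist x (u +ᵥ x) := by
  obtain ⟨p, hp, hw⟩ := hconn.exists_weight_eq x (u +ᵥ x)
  exact hw ▸ map_toReal_le_weight l hl hp

theorem hull_normalizedCycles [Nonempty V] (hconn : Γ.StronglyConnected) :
    PointedCone.hull ℝ Γ.normalizedCycles = ⊤ := by
  have hmem (u : L) : toReal u ∈ PointedCone.hull ℝ Γ.normalizedCycles := by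
    obtain ⟨p, hp⟩ := hconn.exists_isWalk (Classical.arbitrary V) (u +ᵥ Classical.arbitrary V)
    refine AddSubmonoid.closure_induction
      (motive := fun a _ => toReal a.1 ∈ PointedCone.hull ℝ Γ.normalizedCycles) ?_ ?_ ?_
      (mem_closure_cycleVectors hp)
    · rintro ⟨u, _⟩ ⟨q, hq, hu, rfl⟩
      have hmem : _ ∈ Γ.normalizedCycles := ⟨q, u, hq, hu, rfl⟩
      have := PointedCone.smul_mem _ (Nat.cast_nonneg (α := ℝ) (Γ.quotientGraph.weight q))
        (PointedCone.subset_hull (R := ℝ) hmem)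
      rwa [smul_inv_smul₀ (Nat.cast_ne_zero.2 hq.weight_pos.ne')] at this
    · exact toReal_zero (L := L) ▸ zero_mem _
    · exact fun a b _ _ ha hb => toReal_add a.1 b.1 ▸ add_mem ha hb
  refine eq_top_iff.2 fun p _ => ?_
  induction p using TensorProduct.induction_on with
  | zero => exact zero_mem _
  | add a b ha hb => exact add_mem (ha trivial) (hb trivial)
  | tmul r u =>
    rw [← smul_toReal]
    rcases le_total 0 r with hr | hr
    · exact PointedCone.smul_mem _ hr (hmem u)
    · have := PointedCone.smul_mem _ (neg_nonneg.2 hr) (hmem (-u))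
      rwa [toReal_neg, neg_smul_neg] at this

theorem tgt_unique_lift {p p' : List E} {x y y' : V} {g : L} (hp : Γ.IsWalk x p y)
    (hp' : Γ.IsWalk (g +ᵥ x) p' y')
    (h : p.map (Quotient.mk'' : E → AddAction.orbitRel.Quotient L E) = p'.map Quotient.mk'') :
    y' = g +ᵥ y := by
  induction p generalizing p' x with
  | nil =>
    obtain rfl : p' = [] := by simpa using h.symm
    exact hp'.symm.trans (congrArg (g +ᵥ ·) hp)
  | cons e p ih =>
    obtain _ | ⟨e', p'⟩ := p'
    · simp at h
    obtain ⟨he, hpp⟩ := List.cons_eq_cons.1 h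
    obtain ⟨g', rfl⟩ := orbitRel_mk_eq_mk_iff.1 he.symm
    obtain rfl : g' = g := Γ.vadd_injective x (by simpa only [Γ.src_vadd, hp.1] using hp'.1)
    exact ih hp.2 (by simpa only [Γ.tgt_vadd] using hp'.2) hpp

theorem hasVec_unique {q : List (AddAction.orbitRel.Quotient L E)} {u v : L} (hq : q ≠ [])
    (hu : Γ.HasVec q u) (hv : Γ.HasVec q v) : u = v := by
  obtain ⟨p, x, rfl, hp⟩ := hu
  obtain ⟨p', x', hpp, hp'⟩ := hv
  obtain ⟨g, rfl⟩ : ∃ g : L, g +ᵥ x = x' := by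
    obtain _ | ⟨e, p⟩ := p
    · simp at hq
    obtain _ | ⟨e', p'⟩ := p'
    · simp at hpp
    obtain ⟨g, rfl⟩ := orbitRel_mk_eq_mk_iff.1 (List.cons_eq_cons.1 hpp).1
    exact ⟨g, by rw [← hp.1, ← hp'.1, Γ.src_vadd]⟩
  have h := tgt_unique_lift hp hp' hpp.symm
  rw [vadd_comm] at h
  exact (Γ.vadd_injective x (vadd_left_cancel g h)).symm

theorem finite_normalizedCycles (Γ : PeriodicGraph L V E) : Γ.normalizedCycles.Finite := by
  have := Γ.finite_vertex
  have := Γ.finite_edge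
  have := Fintype.ofFinite (AddAction.orbitRel.Quotient L V)
  have hfin : {q | Γ.quotientGraph.IsCycle q}.Finite :=
    (List.finite_length_le _ (Fintype.card (AddAction.orbitRel.Quotient L V))).subset
      fun q hq => by simpa using hq.2.2.length_le_card
  let ν q := {a | ∃ u, Γ.HasVec q u ∧ a = ((Γ.quotientGraph.weight q : ℝ))⁻¹ • toReal u}
  refine (hfin.biUnion (t := ν) fun q hq => Set.Subsingleton.finite ?_).subset ?_
  · rintro _ ⟨u, hu, rfl⟩ _ ⟨v, hv, rfl⟩
    rw [hasVec_unique hq.1 hu hv]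
  · rintro a ⟨q, u, hq, hu, rfl⟩
    exact Set.mem_biUnion (x := q) hq ⟨u, hu, rfl⟩

end PeriodicGraph

/-! ### Nonnegative combinations -/

section NonnegativeCombinations

open Module Filter Topology

variable {W : Type*} [AddCommGroup W] [Module ℝ W]

theorem mem_hull_finset {S : Finset W} {p : W} :
    p ∈ PointedCone.hull ℝ (S : Set W) ↔
      ∃ a : W → ℝ, (∀ s ∈ S, 0 ≤ a s) ∧ ∑ s ∈ S, a s • s = p := by
  constructor
  · intro hp
    obtain ⟨a, -, rfl⟩ := Submodule.mem_span_finset.1 hp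
    exact ⟨fun s => a s, fun s _ => (a s).2, rfl⟩
  · rintro ⟨a, ha, rfl⟩
    exact sum_mem fun s hs => PointedCone.smul_mem _ (ha s hs) (PointedCone.subset_hull hs)

theorem map_nonneg_of_mem_hull {A : Set W} {l : W →ₗ[ℝ] ℝ} (hl : ∀ v ∈ A, 0 ≤ l v) {p : W}
    (hp : p ∈ PointedCone.hull ℝ A) : 0 ≤ l p :=
  (Submodule.span_le (p := (PointedCone.positive ℝ ℝ).comap l)).2 hl hp

theorem map_pos_of_mem_hull {A : Set W} {l : W →ₗ[ℝ] ℝ} (hl : ∀ v ∈ A, 0 < l v) {p : W}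
    (hp : p ∈ PointedCone.hull ℝ A) (hp0 : p ≠ 0) : 0 < l p := by
  refine Submodule.span_induction (p := fun p _ => p ≠ 0 → 0 < l p) (fun v hv _ => hl v hv)
    (absurd rfl) (fun x y _ hy ihx ihy hxy => ?_) (fun r x _ ih hrx => ?_) hp hp0
  · rw [map_add]
    obtain rfl | hx := eq_or_ne x 0
    · simpa using ihy (by simpa using hxy)
    · exact add_pos_of_pos_of_nonneg (ihx hx) (map_nonneg_of_mem_hull (fun v hv => (hl v hv).le) hy)
  · obtain ⟨hr, hx⟩ := smul_ne_zero_iff.1 hrx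
    change 0 < l ((r : ℝ) • x)
    rw [map_smul]
    exact mul_pos (lt_of_le_of_ne r.2 fun h => hr (Subtype.ext h.symm)) (ih hx)

theorem convexHull_subset_hull (A : Set W) :
    convexHull ℝ A ⊆ (PointedCone.hull ℝ A : Set W) :=
  convexHull_min PointedCone.subset_hull (PointedCone.convex _)

theorem inv_smul_mem_convexHull {A : Set W} {l : W →ₗ[ℝ] ℝ} (hl : ∀ v ∈ A, l v = 1) {p : W}
    (hp : p ∈ PointedCone.hull ℝ A) (hpos : 0 < l p) : (l p)⁻¹ • p ∈ convexHull ℝ A := by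
  obtain ⟨a, haA, ha, rfl⟩ := PointedCone.mem_hull_set.1 hp
  have hlp : l (a.sum fun v r => r • v) = ∑ v ∈ a.support, a v := by
    rw [Finsupp.sum, map_sum]
    exact Finset.sum_congr rfl fun v hv => by rw [map_smul, hl v (haA hv), smul_eq_mul, mul_one]
  rw [Finsupp.sum, Finset.smul_sum]
  simp only [smul_smul]
  refine (convex_convexHull ℝ A).sum_mem (fun v _ => mul_nonneg (inv_nonneg.2 hpos.le) (ha v)) ?_
    fun v hv => subset_convexHull ℝ A (haA hv)
  rw [← Finset.mul_sum, ← hlp]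
  exact inv_mul_cancel₀ hpos.ne'

section Basis

variable {ι : Type*} [Finite ι] (b : Basis ι ℝ W)

theorem mem_hull_range_basis_iff {p : W} :
    p ∈ PointedCone.hull ℝ (Set.range b) ↔ ∀ i, 0 ≤ b.repr p i := by
  classical
  have := Fintype.ofFinite ι
  constructor
  · intro hp i
    refine map_nonneg_of_mem_hull (l := b.coord i) ?_ hp
    rintro _ ⟨j, rfl⟩
    rw [b.coord_apply, b.repr_self, Finsupp.single_apply]
    split_ifs <;> norm_num
  · intro hp
    rw [← b.sum_repr p]
    exact sum_mem fun i _ => PointedCone.smul_mem _ (hp i) (PointedCone.subset_hull ⟨i, rfl⟩)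

theorem map_le_map_of_repr_nonneg {l m : W →ₗ[ℝ] ℝ} (hlm : ∀ i, l (b i) ≤ m (b i)) {p : W}
    (hp : ∀ i, 0 ≤ b.repr p i) : l p ≤ m p := by
  refine sub_nonneg.1 (map_nonneg_of_mem_hull (l := m - l) ?_ ((mem_hull_range_basis_iff b).2 hp))
  rintro _ ⟨i, rfl⟩
  exact sub_nonneg.2 (hlm i)

theorem eq_of_le_of_repr_pos {l m : W →ₗ[ℝ] ℝ} (hlm : ∀ i, l (b i) ≤ m (b i)) {p : W}
    (hp : ∀ i, 0 < b.repr p i) (h : m p ≤ l p) : l = m := by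
  have := Fintype.ofFinite ι
  have hsum (k : W →ₗ[ℝ] ℝ) : k p = ∑ i, b.repr p i * k (b i) := by
    conv_lhs => rw [← b.sum_repr p]
    simp only [map_sum, map_smul, smul_eq_mul]
  have hle : ∀ i ∈ Finset.univ, b.repr p i * l (b i) ≤ b.repr p i * m (b i) :=
    fun i _ => mul_le_mul_of_nonneg_left (hlm i) (hp i).le
  have heq := (Finset.sum_eq_sum_iff_of_le hle).1
    (by rw [← hsum, ← hsum]; exact (map_le_map_of_repr_nonneg b hlm fun i => (hp i).le).antisymm h)
  exact b.ext fun i => mul_left_cancel₀ (hp i).ne' (heq i (Finset.mem_univ i))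

theorem exists_sub_smul_mem_hull {p : W} (hp : ∀ i, 0 < b.repr p i) (s : W) :
    ∃ ε : ℝ, 0 < ε ∧ p - ε • s ∈ PointedCone.hull ℝ (Set.range b) := by
  have hev : ∀ᶠ ε in 𝓝[>] (0 : ℝ), ∀ i, 0 < b.repr p i - ε * b.repr s i := by
    refine eventually_all.2 fun i => nhdsWithin_le_nhds ?_
    have hcont : Continuous fun ε : ℝ => b.repr p i - ε * b.repr s i := by fun_prop
    exact hcont.tendsto 0 |>.eventually_const_lt (by simpa using hp i)
  obtain ⟨ε, hε, hpos⟩ := (hev.and self_mem_nhdsWithin).exists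
  exact ⟨ε, hpos, (mem_hull_range_basis_iff b).2 fun i => by simpa using (hε i).le⟩

end Basis

theorem exists_erase_sum_le {S : Finset W} [DecidableEq W] {a : W → ℝ} (ha : ∀ s ∈ S, 0 ≤ a s)
    (hS : ¬ LinearIndepOn ℝ id (S : Set W)) :
    ∃ s₀ ∈ S, ∃ b : W → ℝ, (∀ s ∈ S.erase s₀, 0 ≤ b s) ∧
      ∑ s ∈ S.erase s₀, b s • s = ∑ s ∈ S, a s • s ∧
      ∑ s ∈ S.erase s₀, b s ≤ ∑ s ∈ S, a s := by
  obtain ⟨g, hg0, hgsum, s, hsS, hgs⟩ : ∃ g : W → ℝ,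
      ∑ s ∈ S, g s • s = 0 ∧ 0 ≤ ∑ s ∈ S, g s ∧ ∃ s ∈ S, g s ≠ 0 := by
    obtain ⟨g, hg0, hne⟩ := not_linearIndepOn_finset_iff.1 hS
    rcases le_total 0 (∑ s ∈ S, g s) with hg | hg
    · exact ⟨g, hg0, hg, hne⟩
    · exact ⟨-g, by simpa using hg0, by simpa using hg, by simpa using hne⟩
  have hgpos : ∃ s ∈ S, 0 < g s := by
    by_contra! hle
    exact hgs ((Finset.sum_eq_zero_iff_of_nonpos hle).1
      ((Finset.sum_nonpos hle).antisymm hgsum) s hsS)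
  obtain ⟨s₀, hs₀, hmin⟩ := (S.filter fun s => 0 < g s).exists_min_image (fun s => a s / g s)
    (by simpa [Finset.filter_nonempty_iff] using hgpos)
  obtain ⟨hs₀S, hs₀pos⟩ := Finset.mem_filter.1 hs₀
  set ε := a s₀ / g s₀
  have hε : 0 ≤ ε := div_nonneg (ha s₀ hs₀S) hs₀pos.le
  have hb₀ : a s₀ - ε * g s₀ = 0 := by rw [div_mul_cancel₀ _ hs₀pos.ne', sub_self]
  refine ⟨s₀, hs₀S, fun s => a s - ε * g s, fun s hs => sub_nonneg.2 ?_, ?_, ?_⟩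
  · have hsS := Finset.mem_of_mem_erase hs
    rcases le_or_gt (g s) 0 with hgs | hgs
    · exact (mul_nonpos_of_nonneg_of_nonpos hε hgs).trans (ha s hsS)
    · exact (le_div_iff₀ hgs).1 (hmin s (Finset.mem_filter.2 ⟨hsS, hgs⟩))
  · rw [Finset.sum_erase S (by simp only [hb₀, zero_smul])]
    simp only [sub_smul, Finset.sum_sub_distrib, mul_smul, ← Finset.smul_sum, hg0, smul_zero,
      sub_zero]
  · rw [Finset.sum_erase S hb₀, Finset.sum_sub_distrib, ← Finset.mul_sum]
    exact sub_le_self _ (mul_nonneg hε hgsum)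

/-- Carathéodory's theorem for cones, with control of the sum of the coefficients. -/
theorem exists_linearIndepOn_sum_le (S : Finset W) {a : W → ℝ} (ha : ∀ s ∈ S, 0 ≤ a s) :
    ∃ B ⊆ S, LinearIndepOn ℝ id (B : Set W) ∧ ∃ b : W → ℝ, (∀ v ∈ B, 0 ≤ b v) ∧
      ∑ v ∈ B, b v • v = ∑ s ∈ S, a s • s ∧ ∑ v ∈ B, b v ≤ ∑ s ∈ S, a s := by
  classical
  induction S using Finset.strongInduction generalizing a with
  | H S ih =>
  by_cases hS : LinearIndepOn ℝ id (S : Set W)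
  · exact ⟨S, subset_rfl, hS, a, ha, rfl, le_rfl⟩
  · obtain ⟨s₀, hs₀, a', ha', heq, hle⟩ := exists_erase_sum_le ha hS
    obtain ⟨B, hBS, hB, b, hb, heq', hle'⟩ := ih _ (Finset.erase_ssubset hs₀) ha'
    exact ⟨B, hBS.trans (Finset.erase_subset _ _), hB, b, hb, heq'.trans heq, hle'.trans hle⟩

theorem exists_map_eq_one {A : Set W} (hA : LinearIndepOn ℝ id A) :
    ∃ l : W →ₗ[ℝ] ℝ, ∀ v ∈ A, l v = 1 := by
  refine ⟨(Basis.extend hA).constr ℝ fun _ => 1, fun v hv => ?_⟩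
  have := (Basis.extend hA).constr_basis ℝ (fun _ => (1 : ℝ)) ⟨v, hA.subset_extend _ hv⟩
  rwa [Basis.extend_apply_self] at this

/-- A vector in no proper subspace spanned by elements of `S`. -/
def Generic (S : Set W) (p : W) : Prop :=
  ∀ A ⊆ S, p ∈ Submodule.span ℝ A → Submodule.span ℝ A = ⊤

namespace Generic

variable {S : Set W} {p ξ : W}

theorem ne_zero [Nontrivial W] (hp : Generic S p) : p ≠ 0 := by
  rintro rfl
  exact bot_ne_top (Submodule.span_empty.symm.trans (hp ∅ (Set.empty_subset _) (zero_mem _)))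

theorem repr_ne_zero (hp : Generic S p) {ι : Type*} (b : Basis ι ℝ W) (hb : Set.range b ⊆ S)
    (i : ι) : b.repr p i ≠ 0 := by
  intro h0
  have hmem : p ∈ Submodule.span ℝ (b '' {i}ᶜ) := by
    rw [b.mem_span_image]
    rintro j hj rfl
    exact Finsupp.mem_support_iff.1 hj h0
  have htop := hp _ ((Set.image_subset_range _ _).trans hb) hmem
  have hbi : b i ∈ Submodule.span ℝ (b '' {i}ᶜ) := htop ▸ Submodule.mem_top
  rw [b.mem_span_image, b.repr_self] at hbi
  exact hbi (by simp) rfl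

theorem repr_pos (hp : Generic S p) {ι : Type*} [Finite ι] (b : Basis ι ℝ W)
    (hb : Set.range b ⊆ S) (hpb : p ∈ PointedCone.hull ℝ (Set.range b)) (i : ι) :
    0 < b.repr p i :=
  ((mem_hull_range_basis_iff b).1 hpb i).lt_of_ne (hp.repr_ne_zero b hb i).symm

theorem neg (hξ : Generic S ξ) : Generic S (-ξ) :=
  fun A hA h => hξ A hA (neg_mem_iff.1 h)

theorem eventually_add_smul (hS : S.Finite) (hξ : Generic S ξ) (p : W) :
    ∀ᶠ ε in 𝓝[>] (0 : ℝ), Generic S (p + ε • ξ) := by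
  refine (eventually_all_finite hS.finite_subsets).2 fun A hA => ?_
  by_cases htop : Submodule.span ℝ A = ⊤
  · exact Eventually.of_forall fun _ _ => htop
  have hsub : {ε : ℝ | p + ε • ξ ∈ Submodule.span ℝ A}.Subsingleton := by
    intro ε hε δ hδ
    by_contra hne
    have hdiff : (ε - δ) • ξ ∈ Submodule.span ℝ A := by
      have hmem := Submodule.sub_mem _ (Set.mem_ofPred.1 hε) (Set.mem_ofPred.1 hδ)
      rwa [add_sub_add_left_eq_sub, ← sub_smul] at hmem
    exact htop (hξ A hA ((Submodule.smul_mem_iff _ (sub_ne_zero.2 hne)).1 hdiff))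
  have hle : 𝓝[>] (0 : ℝ) ≤ cofinite :=
    (nhdsWithin_mono 0 fun _ hx => ne_of_gt hx).trans (nhdsNE_le_cofinite 0)
  filter_upwards [hle hsub.finite.compl_mem_cofinite] with ε hε hmem using absurd hmem hε

end Generic

theorem exists_generic {S : Set W} (hS : S.Finite) : ∃ ξ : W, Generic S ξ := by
  have hfin : ((fun A => Submodule.span ℝ A) '' {A | A ⊆ S} \ {⊤}).Finite :=
    (hS.finite_subsets.image _).sdiff
  obtain ⟨ξ, hξ⟩ := (Set.ne_univ_iff_exists_notMem _).1
    (Subspace.biUnion_ne_univ_of_top_notMem (s := hfin.toFinset) (by simp))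
  refine ⟨ξ, fun A hA hmem => by_contra fun hne => hξ ?_⟩
  exact Set.mem_biUnion (x := Submodule.span ℝ A)
    (hfin.mem_toFinset.2 ⟨Set.mem_image_of_mem _ hA, hne⟩) hmem

theorem Generic.exists_sum_lt {S B : Finset W} {p s : W} (hgen : Generic (S : Set W) p)
    (hBS : B ⊆ S) (hB : LinearIndepOn ℝ id (B : Set W)) (hpB : p ∈ PointedCone.hull ℝ (B : Set W))
    (hs : s ∈ S) {l : W →ₗ[ℝ] ℝ} (hlB : ∀ v ∈ B, l v = 1) (hls : 1 < l s) :
    ∃ a : W → ℝ, (∀ v ∈ S, 0 ≤ a v) ∧ ∑ v ∈ S, a v • v = p ∧ ∑ v ∈ S, a v < l p := by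
  classical
  have hspan : Submodule.span ℝ (B : Set W) = ⊤ :=
    hgen B (Finset.coe_subset.2 hBS) (PointedCone.hull_le_span ℝ _ hpB)
  let b : Basis B ℝ W := Basis.mk hB (by simpa using hspan.ge)
  have hb : Set.range b = B := by simp [b]
  obtain ⟨ε, hε, hmem⟩ := exists_sub_smul_mem_hull b
    (hgen.repr_pos b (by rw [hb]; exact Finset.coe_subset.2 hBS) (hb ▸ hpB)) s
  rw [hb, mem_hull_finset] at hmem
  obtain ⟨c, hc, hcp⟩ := hmem
  have hcsum : ∑ v ∈ B, c v = l p - ε * l s := by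
    rw [← smul_eq_mul, ← map_smul, ← map_sub, ← hcp, map_sum]
    exact Finset.sum_congr rfl fun v hv => by rw [map_smul, hlB v hv, smul_eq_mul, mul_one]
  refine ⟨fun v => (if v ∈ B then c v else 0) + if v = s then ε else 0, fun v _ => ?_, ?_, ?_⟩
  · have : v ∈ B → 0 ≤ c v := hc v
    dsimp only
    split_ifs <;> simp_all [hε.le, add_nonneg]
  · simp only [add_smul, ite_smul, zero_smul, Finset.sum_add_distrib, Finset.sum_ite_mem,
      Finset.inter_eq_right.2 hBS, Finset.sum_ite_eq', hs, if_true, hcp, sub_add_cancel]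
  · simp only [Finset.sum_add_distrib, Finset.sum_ite_mem, Finset.inter_eq_right.2 hBS,
      Finset.sum_ite_eq', hs, if_true, hcsum]
    nlinarith

/-- Among the bases `B ⊆ S` with `p` in the cone over `B`, one on which the sum of the coordinates
of `p` is least has all of `S` on one side of its affine span: a violating element of `S` could
be exchanged into `B`, which would lower that sum. -/
theorem Generic.exists_supporting {S : Finset W} {p : W} (hgen : Generic (S : Set W) p)
    (hp : p ∈ PointedCone.hull ℝ (S : Set W)) :
    ∃ B ⊆ S, p ∈ PointedCone.hull ℝ (B : Set W) ∧
      ∃ l : W →ₗ[ℝ] ℝ, (∀ v ∈ B, l v = 1) ∧ ∀ s ∈ S, l s ≤ 1 := by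
  classical
  choose! l hl using fun (B : Finset W) (hB : LinearIndepOn ℝ id (B : Set W)) =>
    exists_map_eq_one hB
  let 𝓑 : Finset (Finset W) := S.powerset.filter fun B =>
    LinearIndepOn ℝ id (B : Set W) ∧ p ∈ PointedCone.hull ℝ (B : Set W)
  have hexch (a : W → ℝ) (ha : ∀ s ∈ S, 0 ≤ a s) (hap : ∑ s ∈ S, a s • s = p) :
      ∃ B ∈ 𝓑, l B p ≤ ∑ s ∈ S, a s := by
    obtain ⟨B, hBS, hB, b, hb, hbp, hle⟩ := exists_linearIndepOn_sum_le S ha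
    rw [hap] at hbp
    refine ⟨B, Finset.mem_filter.2 ⟨Finset.mem_powerset.2 hBS, hB, mem_hull_finset.2 ⟨b, hb, hbp⟩⟩,
      le_of_eq_of_le ?_ hle⟩
    rw [← hbp, map_sum]
    exact Finset.sum_congr rfl fun v hv => by rw [map_smul, hl B hB v hv, smul_eq_mul, mul_one]
  obtain ⟨a, ha, hap⟩ := mem_hull_finset.1 hp
  obtain ⟨B₀, hB₀, -⟩ := hexch a ha hap
  obtain ⟨B, hB, hmin⟩ := 𝓑.exists_min_image (fun B => l B p) ⟨B₀, hB₀⟩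
  obtain ⟨hBS, hBind, hpB⟩ := Finset.mem_filter.1 hB
  rw [Finset.mem_powerset] at hBS
  refine ⟨B, hBS, hpB, l B, hl B hBind, fun s hs => not_lt.1 fun hlt => ?_⟩
  obtain ⟨a', ha', hap', hsum⟩ := hgen.exists_sum_lt hBS hBind hpB hs (hl B hBind) hlt
  obtain ⟨B', hB', hle⟩ := hexch a' ha' hap'
  exact (hmin B' hB').not_gt (hle.trans_lt hsum)

end NonnegativeCombinations

/-- The positive reals, together with `0` if `p` holds. -/
def halfLine (p : Prop) : Set ℝ := {r | 0 < r ∨ (r = 0 ∧ p)}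

theorem nonneg_of_mem_halfLine {p : Prop} {r : ℝ} (hr : r ∈ halfLine p) : 0 ≤ r :=
  hr.elim le_of_lt fun h => h.1.ge

theorem isUpperSet_halfLine (p : Prop) : IsUpperSet (halfLine p) := by
  rintro r r' hr (h | ⟨rfl, hp⟩)
  · exact Or.inl (h.trans_le hr)
  · exact hr.lt_or_eq.imp id fun h => ⟨h.symm, hp⟩

theorem neg_mem_halfLine_not_iff {p : Prop} {r : ℝ} : -r ∈ halfLine (¬ p) ↔ r ∉ halfLine p := by
  rcases lt_trichotomy r 0 with hr | rfl | hr
  · simp [halfLine, hr, hr.not_gt, hr.ne]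
  · simp [halfLine]
  · simp [halfLine, hr, hr.not_gt, hr.ne']

/-! ### Facets and their triangulations -/

section Facets

open Module Filter Topology

variable {W : Type*} [AddCommGroup W] [Module ℝ W]

theorem span_eq_top_of_hull_eq_top {S : Set W} (hS : PointedCone.hull ℝ S = ⊤) :
    Submodule.span ℝ S = ⊤ :=
  eq_top_iff.2 fun _ _ => PointedCone.hull_le_span ℝ S (hS ▸ Submodule.mem_top)

theorem vectorSpan_of_zero_mem {P : Set W} (h0 : (0 : W) ∈ P) :
    vectorSpan ℝ P = Submodule.span ℝ P := by
  simp [vectorSpan_eq_span_vsub_set_right ℝ h0]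

theorem affDim_convexHull {S : Set W} (h0 : (0 : W) ∈ S) (hS : Submodule.span ℝ S = ⊤) :
    affDim (convexHull ℝ S) = finrank ℝ W := by
  rw [affDim, ← direction_affineSpan, affineSpan_convexHull, direction_affineSpan,
    vectorSpan_of_zero_mem h0, hS, finrank_top]

theorem affDim_lt_finrank [FiniteDimensional ℝ W] {F : Set W} {l : W →ₗ[ℝ] ℝ} (hl : l ≠ 0) {c : ℝ}
    (hF : ∀ x ∈ F, l x = c) : affDim F < finrank ℝ W := by
  have hle : vectorSpan ℝ F ≤ LinearMap.ker l := by
    rw [vectorSpan_def, Submodule.span_le]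
    rintro _ ⟨x, hx, y, hy, rfl⟩
    simp [hF x hx, hF y hy]
  exact (Submodule.finrank_mono hle).trans_lt (Submodule.finrank_lt (by simpa using hl))

theorem finrank_le_affDim_add_one [FiniteDimensional ℝ W] {F : Set W}
    (hF : Submodule.span ℝ F = ⊤) : finrank ℝ W ≤ affDim F + 1 := by
  obtain rfl | ⟨s₀, hs₀⟩ := F.eq_empty_or_nonempty
  · rw [← finrank_top ℝ W, ← hF, Submodule.span_empty, finrank_bot]
    exact Nat.zero_le _
  have hle : Submodule.span ℝ F ≤ vectorSpan ℝ F ⊔ Submodule.span ℝ {s₀} := by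
    refine Submodule.span_le.2 fun s hs => ?_
    simpa using Submodule.add_mem_sup (vsub_mem_vectorSpan ℝ hs hs₀)
      (Submodule.mem_span_singleton_self (R := ℝ) s₀)
  calc finrank ℝ W = finrank ℝ (Submodule.span ℝ F) := by rw [hF, finrank_top]
    _ ≤ finrank ℝ (vectorSpan ℝ F) + finrank ℝ (Submodule.span ℝ {s₀}) :=
      (Submodule.finrank_mono hle).trans (Submodule.finrank_add_le_finrank_add_finrank _ _)
    _ ≤ affDim F + 1 := Nat.add_le_add_left (finrank_span_le_card {s₀} |>.trans (by simp)) _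

theorem map_le_of_mem_convexHull {S : Set W} {l : W →ₗ[ℝ] ℝ} {c : ℝ} (h : ∀ s ∈ S, l s ≤ c)
    {x : W} (hx : x ∈ convexHull ℝ S) : l x ≤ c :=
  convexHull_min (t := {x | l x ≤ c}) h (convex_halfSpace_le l.isLinear c) hx

theorem map_eq_of_mem_convexHull {S : Set W} {l : W →ₗ[ℝ] ℝ} {c : ℝ} (h : ∀ s ∈ S, l s = c)
    {x : W} (hx : x ∈ convexHull ℝ S) : l x = c :=
  convexHull_min (t := {x | l x = c}) h (convex_hyperplane l.isLinear c) hx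

theorem isFacet_of_span_eq_top [FiniteDimensional ℝ W] {S : Set W} (h0 : (0 : W) ∈ S)
    {l : W →ₗ[ℝ] ℝ} (hl : ∀ s ∈ S, l s ≤ 1) {A : Set W} (hAS : A ⊆ S) (hA : ∀ s ∈ A, l s = 1)
    (hAne : A.Nonempty) (hspan : Submodule.span ℝ A = ⊤) :
    IsFacet (convexHull ℝ S) {x ∈ convexHull ℝ S | l x = 1} := by
  have hAF : A ⊆ {x ∈ convexHull ℝ S | l x = 1} :=
    fun s hs => ⟨subset_convexHull ℝ _ (hAS hs), hA s hs⟩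
  have hl0 : l ≠ 0 := by
    rintro rfl
    exact zero_ne_one (hA _ hAne.some_mem)
  refine ⟨⟨l, 1, fun x hx => map_le_of_mem_convexHull hl hx, rfl⟩, hAne.mono hAF, ?_⟩
  rw [affDim_convexHull h0 (top_unique (hspan.ge.trans (Submodule.span_mono hAS)))]
  exact le_antisymm (affDim_lt_finrank hl0 fun x hx => hx.2)
    (finrank_le_affDim_add_one (top_unique (hspan.ge.trans (Submodule.span_mono hAF))))

theorem IsFacet.exists_normal {S : Set W} (h0 : (0 : W) ∈ S) (hS : PointedCone.hull ℝ S = ⊤)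
    {σ : Set W} (hσ : IsFacet (convexHull ℝ S) σ) :
    ∃ l : W →ₗ[ℝ] ℝ, (∀ x ∈ convexHull ℝ S, l x ≤ 1) ∧ σ = {x ∈ convexHull ℝ S | l x = 1} := by
  obtain ⟨⟨l, c, hl, rfl⟩, -, hdim⟩ := hσ
  have hsub : S ⊆ convexHull ℝ S := subset_convexHull ℝ _
  have hc : c ≠ 0 := by
    rintro rfl
    have hle (p : W) : l p ≤ 0 := by
      have hp : 0 ≤ (-l) p := map_nonneg_of_mem_hull (A := S)
        (fun s hs => neg_nonneg.2 (hl s (hsub hs))) (hS ▸ Submodule.mem_top)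
      exact neg_nonneg.1 hp
    have heq (p : W) : l p = 0 := (hle p).antisymm (by simpa using hle (-p))
    simp [heq] at hdim
  have hcpos : 0 < c := (by simpa using hl 0 (hsub h0) : 0 ≤ c).lt_of_ne hc.symm
  refine ⟨c⁻¹ • l, fun x hx => ?_, ?_⟩
  · simpa [inv_mul_le_iff₀ hcpos] using hl x hx
  · ext x
    simp [inv_mul_eq_iff_eq_mul₀ hc]

theorem IsFace.isExtreme {P F : Set W} (h : IsFace P F) : IsExtreme ℝ P F := by
  obtain ⟨l, c, hl, rfl⟩ := h
  refine (isExtreme_iff ℝ P _).2 ⟨fun x hx => hx.1, ?_⟩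
  rintro x hx y hy z ⟨-, hz⟩ ⟨a, b, ha, hb, hab, rfl⟩
  rw [map_add, map_smul, map_smul, smul_eq_mul, smul_eq_mul] at hz
  refine ⟨hx, (hl x hx).eq_of_not_lt fun hlt => ?_⟩
  have hlt' : a * l x + b * l y < a * c + b * c :=
    add_lt_add_of_lt_of_le (mul_lt_mul_of_pos_left hlt ha)
      (mul_le_mul_of_nonneg_left (hl y hy) hb.le)
  rw [hz, ← add_mul, hab, one_mul] at hlt'
  exact hlt'.false

theorem eventually_add_mul_pos_iff (a b : ℝ) :
    ∀ᶠ ε in 𝓝[>] (0 : ℝ), (0 < a + ε * b ↔ a ∈ halfLine (0 < b)) := by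
  have hlim : Tendsto (fun ε : ℝ => a + ε * b) (𝓝[>] 0) (𝓝 a) := by
    have hcont : Continuous fun ε : ℝ => a + ε * b := by fun_prop
    simpa using (hcont.tendsto 0).mono_left nhdsWithin_le_nhds
  rcases lt_trichotomy a 0 with ha | ha | ha
  · filter_upwards [hlim.eventually_lt_const ha] with ε hε
    simp [halfLine, ha.not_gt, ha.ne, hε.le]
  · filter_upwards [self_mem_nhdsWithin] with ε (hε : 0 < ε)
    simp [halfLine, ha, mul_pos_iff_of_pos_left hε]
  · filter_upwards [hlim.eventually_const_lt ha] with ε hε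
    simp [halfLine, ha, hε]

/-- The polytope `conv S` contains `0` in its interior, and `T` triangulates each of its facets
without new vertices. -/
structure FacetTriangulation (S : Finset W) (T : Set W → Finset (Finset W)) : Prop where
  zero_mem : (0 : W) ∈ S
  hull_eq_top : PointedCone.hull ℝ (S : Set W) = ⊤
  triangulation : ∀ σ, IsFacet (convexHull ℝ (S : Set W)) σ → IsTriangulation σ (T σ)
  vertices : ∀ σ, IsFacet (convexHull ℝ (S : Set W)) σ → ∀ Δ ∈ T σ,
    (Δ : Set W) ⊆ σ.extremePoints ℝ

namespace FacetTriangulation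

variable {S : Finset W} {T : Set W → Finset (Finset W)} {σ : Set W} {Δ Δ' : Finset W} {p ξ : W}

/-- The maximal simplices of the triangulations of all facets. -/
def simplices (S : Finset W) (T : Set W → Finset (Finset W)) : Set (Finset W) :=
  {Δ | ∃ σ, IsFacet (convexHull ℝ (S : Set W)) σ ∧ Δ ∈ T σ}

theorem mem_simplices (hσ : IsFacet (convexHull ℝ (S : Set W)) σ) (hΔ : Δ ∈ T σ) :
    Δ ∈ simplices S T :=
  ⟨σ, hσ, hΔ⟩

theorem finiteDimensional (h : FacetTriangulation S T) : FiniteDimensional ℝ W :=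
  ⟨⟨S, span_eq_top_of_hull_eq_top h.hull_eq_top⟩⟩

theorem subset_extremePoints (h : FacetTriangulation S T) (hΔ : Δ ∈ simplices S T) :
    (Δ : Set W) ⊆ (convexHull ℝ (S : Set W)).extremePoints ℝ := by
  obtain ⟨σ, hσ, hΔ⟩ := hΔ
  exact (h.vertices σ hσ Δ hΔ).trans hσ.1.isExtreme.extremePoints_subset_extremePoints

theorem subset_generators (h : FacetTriangulation S T) (hΔ : Δ ∈ simplices S T) : Δ ⊆ S :=
  Finset.coe_subset.1 ((h.subset_extremePoints hΔ).trans extremePoints_convexHull_subset)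

theorem finite_simplices (h : FacetTriangulation S T) : (simplices S T).Finite :=
  S.powerset.finite_toSet.subset fun _ hΔ =>
    Finset.mem_coe.2 (Finset.mem_powerset.2 (h.subset_generators hΔ))

theorem exists_normal (h : FacetTriangulation S T) (hσ : IsFacet (convexHull ℝ (S : Set W)) σ)
    (hΔ : Δ ∈ T σ) : ∃ l : W →ₗ[ℝ] ℝ, (∀ s ∈ S, l s ≤ 1) ∧
      σ = {x ∈ convexHull ℝ (S : Set W) | l x = 1} ∧ ∀ v ∈ Δ, l v = 1 := by
  obtain ⟨l, hl, hσl⟩ := hσ.exists_normal h.zero_mem h.hull_eq_top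
  refine ⟨l, fun s hs => hl s (subset_convexHull ℝ _ hs), hσl, fun v hv => ?_⟩
  have hvσ : v ∈ σ := extremePoints_subset (h.vertices σ hσ Δ hΔ hv)
  rw [hσl] at hvσ
  exact hvσ.2

theorem linearIndependent (h : FacetTriangulation S T) (hΔ : Δ ∈ simplices S T) :
    LinearIndependent ℝ (fun v : Δ => (v : W)) := by
  obtain ⟨σ, hσ, hΔ⟩ := hΔ
  obtain ⟨l, -, -, hl⟩ := h.exists_normal hσ hΔ
  refine linearIndependent_iff'.2 fun s g hg => affineIndependent_iff.1
    ((h.triangulation σ hσ).indep Δ hΔ) s g ?_ hg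
  have hlg := congrArg l hg
  rw [map_sum, map_zero] at hlg
  rw [← hlg]
  exact Finset.sum_congr rfl fun v _ => by rw [map_smul, hl v v.2, smul_eq_mul, mul_one]

theorem card_eq (h : FacetTriangulation S T) (hΔ : Δ ∈ simplices S T) :
    Δ.card = finrank ℝ W := by
  obtain ⟨σ, hσ, hΔ⟩ := hΔ
  rw [(h.triangulation σ hσ).card_eq Δ hΔ, hσ.2.2,
    affDim_convexHull h.zero_mem (span_eq_top_of_hull_eq_top h.hull_eq_top)]

/-- The basis consisting of the vertices of a simplex. -/
def basis (h : FacetTriangulation S T) (hΔ : Δ ∈ simplices S T) : Basis Δ ℝ W :=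
  have := h.finiteDimensional
  Basis.mk (h.linearIndependent hΔ)
    ((h.linearIndependent hΔ).span_eq_top_of_card_eq_finrank'
      (by rw [Fintype.card_coe, h.card_eq hΔ])).ge

@[simp] theorem basis_apply (h : FacetTriangulation S T) (hΔ : Δ ∈ simplices S T) (v : Δ) :
    h.basis hΔ v = v := by
  simp [basis]

theorem range_basis (h : FacetTriangulation S T) (hΔ : Δ ∈ simplices S T) :
    Set.range (h.basis hΔ) = Δ := by
  simp [basis]

theorem mem_hull_iff (h : FacetTriangulation S T) (hΔ : Δ ∈ simplices S T) :
    p ∈ PointedCone.hull ℝ (Δ : Set W) ↔ ∀ v, 0 ≤ (h.basis hΔ).repr p v := by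
  rw [← mem_hull_range_basis_iff, range_basis]

theorem exists_pos [Nontrivial W] (h : FacetTriangulation S T) (hp : Generic (S : Set W) p) :
    ∃ Δ, ∃ hΔ : Δ ∈ simplices S T, ∀ v, 0 < (h.basis hΔ).repr p v := by
  have := h.finiteDimensional
  obtain ⟨B, hBS, hpB, l, hlB, hlS⟩ := hp.exists_supporting (h.hull_eq_top ▸ Submodule.mem_top)
  have hBS' : (B : Set W) ⊆ S := Finset.coe_subset.2 hBS
  have hspan : Submodule.span ℝ (B : Set W) = ⊤ := hp B hBS' (PointedCone.hull_le_span ℝ _ hpB)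
  have hBne : (B : Set W).Nonempty := Set.nonempty_iff_ne_empty.2 fun hB => by
    rw [hB, Submodule.span_empty] at hspan
    exact bot_ne_top hspan
  have hlp : 0 < l p :=
    map_pos_of_mem_hull (fun v hv => by rw [hlB v hv]; exact one_pos) hpB hp.ne_zero
  have hF := isFacet_of_span_eq_top h.zero_mem hlS hBS' hlB hBne hspan
  have hmem : (l p)⁻¹ • p ∈ convexHull ℝ (B : Set W) := inv_smul_mem_convexHull hlB hpB hlp
  have hpF : (l p)⁻¹ • p ∈ {x ∈ convexHull ℝ (S : Set W) | l x = 1} :=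
    ⟨convexHull_mono hBS' hmem, map_eq_of_mem_convexHull hlB hmem⟩
  rw [(h.triangulation _ hF).union_eq] at hpF
  obtain ⟨Δ, hΔ, hmem⟩ := Set.mem_iUnion₂.1 hpF
  have hΔ' : Δ ∈ simplices S T := ⟨_, hF, hΔ⟩
  have hpΔ := PointedCone.smul_mem _ hlp.le (convexHull_subset_hull _ hmem)
  rw [smul_inv_smul₀ hlp.ne'] at hpΔ
  rw [← h.range_basis hΔ'] at hpΔ
  exact ⟨Δ, hΔ', hp.repr_pos _ (by
    rw [h.range_basis]
    exact Finset.coe_subset.2 (h.subset_generators hΔ')) hpΔ⟩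

theorem ne_zero_of_pos [Nontrivial W] (h : FacetTriangulation S T) (hΔ : Δ ∈ simplices S T)
    (hp : ∀ v, 0 < (h.basis hΔ).repr p v) : p ≠ 0 := by
  rintro rfl
  have := h.finiteDimensional
  obtain ⟨v, hv⟩ := Finset.card_pos.1 (finrank_pos.trans_eq (h.card_eq hΔ).symm)
  simpa using hp ⟨v, hv⟩

theorem facet_eq_of_pos (h : FacetTriangulation S T) {σ' : Set W}
    (hσ : IsFacet (convexHull ℝ (S : Set W)) σ) (hσ' : IsFacet (convexHull ℝ (S : Set W)) σ')
    (hΔ : Δ ∈ T σ) (hΔ' : Δ' ∈ T σ') (hp : ∀ v, 0 < (h.basis (mem_simplices hσ hΔ)).repr p v)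
    (hp' : ∀ v, 0 < (h.basis (mem_simplices hσ' hΔ')).repr p v) : σ = σ' := by
  obtain ⟨l, hl, hσl, hlΔ⟩ := h.exists_normal hσ hΔ
  obtain ⟨l', hl', hσl', hlΔ'⟩ := h.exists_normal hσ' hΔ'
  let b := h.basis (mem_simplices hσ hΔ)
  let b' := h.basis (mem_simplices hσ' hΔ')
  have hle (v : Δ) : l' (b v) ≤ l (b v) := by
    rw [basis_apply, hlΔ v v.2]
    exact hl' v (h.subset_generators (mem_simplices hσ hΔ) v.2)
  have hle' (v : Δ') : l (b' v) ≤ l' (b' v) := by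
    rw [basis_apply, hlΔ' v v.2]
    exact hl v (h.subset_generators (mem_simplices hσ' hΔ') v.2)
  rw [hσl, hσl', eq_of_le_of_repr_pos b hle hp
    (map_le_map_of_repr_nonneg b' hle' fun v => (hp' v).le)]

theorem simplex_subset_of_pos [Nontrivial W] (h : FacetTriangulation S T)
    (hσ : IsFacet (convexHull ℝ (S : Set W)) σ) (hΔ : Δ ∈ T σ) (hΔ' : Δ' ∈ T σ)
    (hp : ∀ v, 0 < (h.basis (mem_simplices hσ hΔ)).repr p v)
    (hp' : p ∈ PointedCone.hull ℝ (Δ' : Set W)) : Δ ⊆ Δ' := by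
  obtain ⟨l, -, hσl, hlΔ⟩ := h.exists_normal hσ hΔ
  have hT := h.triangulation σ hσ
  have hΔσ : convexHull ℝ (Δ' : Set W) ⊆ σ := by
    rw [hT.union_eq]
    exact Set.subset_biUnion_of_mem (u := fun Δ : Finset W => convexHull ℝ (Δ : Set W)) hΔ'
  have hlΔ' : ∀ v ∈ Δ', l v = 1 := fun v hv => by
    have := hΔσ (subset_convexHull ℝ _ hv)
    rw [hσl] at this
    exact this.2
  have hpΔ : p ∈ PointedCone.hull ℝ (Δ : Set W) :=
    (h.mem_hull_iff (mem_simplices hσ hΔ)).2 fun v => (hp v).le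
  have hlp : 0 < l p := map_pos_of_mem_hull (fun v hv => by rw [hlΔ v hv]; exact one_pos) hpΔ
    (h.ne_zero_of_pos (mem_simplices hσ hΔ) hp)
  obtain ⟨m, k, hm, hface⟩ := hT.inter_face Δ hΔ Δ' hΔ'
  have hmp : m ((l p)⁻¹ • p) = k := by
    have hmem := Set.mem_inter (inv_smul_mem_convexHull hlΔ hpΔ hlp)
      (inv_smul_mem_convexHull hlΔ' hp' hlp)
    rw [hface] at hmem
    exact hmem.2
  rw [map_smul, smul_eq_mul, inv_mul_eq_iff_eq_mul₀ hlp.ne'] at hmp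
  have hmk : m = k • l := by
    refine eq_of_le_of_repr_pos (h.basis (mem_simplices hσ hΔ)) (fun v => ?_) hp ?_
    · rw [basis_apply, LinearMap.smul_apply, hlΔ v v.2, smul_eq_mul, mul_one]
      exact hm v (subset_convexHull ℝ _ v.2)
    · rw [hmp, LinearMap.smul_apply, smul_eq_mul, mul_comm]
  intro v hv
  have hvface : v ∈ convexHull ℝ (Δ : Set W) ∩ convexHull ℝ (Δ' : Set W) := by
    rw [hface]
    exact ⟨subset_convexHull ℝ _ hv, by simp [hmk, hlΔ v hv]⟩
  exact extremePoints_convexHull_subset (inter_extremePoints_subset_extremePoints_of_subset hΔσ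
    ⟨hvface.2, h.vertices σ hσ Δ hΔ hv⟩)

theorem eq_of_pos [Nontrivial W] (h : FacetTriangulation S T) (hΔ : Δ ∈ simplices S T)
    (hΔ' : Δ' ∈ simplices S T) (hp : ∀ v, 0 < (h.basis hΔ).repr p v)
    (hp' : ∀ v, 0 < (h.basis hΔ').repr p v) : Δ = Δ' := by
  obtain ⟨σ, hσ, hΔσ⟩ := id hΔ
  obtain ⟨σ', hσ', hΔσ'⟩ := id hΔ'
  obtain rfl := h.facet_eq_of_pos hσ hσ' hΔσ hΔσ' hp hp'
  exact (h.simplex_subset_of_pos hσ hΔσ hΔσ' hp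
    ((h.mem_hull_iff hΔ').2 fun v => (hp' v).le)).antisymm
    (h.simplex_subset_of_pos hσ hΔσ' hΔσ hp' ((h.mem_hull_iff hΔ).2 fun v => (hp v).le))

/-- The cone over `Δ` without those facets of the cone which separate it from `ξ`; the points `p`
such that `p + ε ξ` is in its interior for all small `ε > 0`. -/
def HalfOpen (h : FacetTriangulation S T) (ξ : W) (hΔ : Δ ∈ simplices S T) (p : W) : Prop :=
  ∀ v, (h.basis hΔ).repr p v ∈ halfLine (0 < (h.basis hΔ).repr ξ v)

theorem halfOpen_neg_iff (h : FacetTriangulation S T) (hξ : Generic (S : Set W) ξ)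
    (hΔ : Δ ∈ simplices S T) : h.HalfOpen (-ξ) hΔ (-p) ↔
      ∀ v, -(h.basis hΔ).repr p v ∈ halfLine (¬ 0 < (h.basis hΔ).repr ξ v) := by
  refine forall_congr' fun v => ?_
  have hne := hξ.repr_ne_zero (h.basis hΔ) (by
    rw [h.range_basis]
    exact Finset.coe_subset.2 (h.subset_generators hΔ)) v
  rw [map_neg, map_neg, Finsupp.neg_apply, Finsupp.neg_apply, neg_pos, not_lt, hne.le_iff_lt]

theorem existsUnique_halfOpen [Nontrivial W] (h : FacetTriangulation S T)
    (hξ : Generic (S : Set W) ξ) (p : W) : ∃! Δ : simplices S T, h.HalfOpen ξ Δ.2 p := by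
  have hfin : Finite (simplices S T) := h.finite_simplices
  have hev : ∀ᶠ ε in 𝓝[>] (0 : ℝ), ∀ Δ : simplices S T,
      h.HalfOpen ξ Δ.2 p ↔ ∀ v, 0 < (h.basis Δ.2).repr (p + ε • ξ) v := by
    refine eventually_all.2 fun Δ => ?_
    filter_upwards [eventually_all.2 fun v => eventually_add_mul_pos_iff
      ((h.basis Δ.2).repr p v) ((h.basis Δ.2).repr ξ v)] with ε hε
    exact forall_congr' fun v => by simpa using (hε v).symm
  obtain ⟨ε, hiff, hgen⟩ := (hev.and (hξ.eventually_add_smul S.finite_toSet p)).exists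
  obtain ⟨Δ, hΔ, hpos⟩ := h.exists_pos hgen
  exact ⟨⟨Δ, hΔ⟩, (hiff _).2 hpos, fun Δ' hΔ' =>
    Subtype.ext (h.eq_of_pos Δ'.2 hΔ ((hiff _).1 hΔ') hpos)⟩

end FacetTriangulation

end Facets

/-! ### Generating functions of the vertices in a cone -/

section GeneratingFunctions

open scoped Pointwise

variable {L V : Type*} [AddCommGroup L] [AddAction L V]

/-- The generating function `∑ t ^ f(y)` over `y ∈ A`. -/
def genFun (f : V → ℕ) (A : Set V) : ℚ⟦X⟧ :=
  PowerSeries.mk fun m => ({y ∈ A | f y = m}.ncard : ℚ)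

theorem coeff_genFun (f : V → ℕ) (A : Set V) (m : ℕ) :
    PowerSeries.coeff m (genFun f A) = {y ∈ A | f y = m}.ncard := by
  rw [genFun, PowerSeries.coeff_mk]

theorem genFun_eq_sum {f : V → ℕ} {A : Set V} (hA : A.Finite) :
    genFun f A = ((∑ y ∈ hA.toFinset, (Polynomial.X : ℚ[X]) ^ f y : ℚ[X]) : ℚ⟦X⟧) := by
  classical
  ext m
  rw [coeff_genFun, Polynomial.coeff_coe, Polynomial.finsetSum_coeff]
  simp only [Polynomial.coeff_X_pow, Finset.sum_boole]
  rw [← Set.ncard_coe_finset]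
  congr 2
  ext y
  simp [eq_comm]

theorem genFun_union {f : V → ℕ} (hf : ∀ m, {y | f y = m}.Finite) {A B : Set V}
    (hAB : Disjoint A B) : genFun f (A ∪ B) = genFun f A + genFun f B := by
  ext m
  have hfin (C : Set V) : {y ∈ C | f y = m}.Finite := (hf m).subset fun y hy => hy.2
  have hunion : {y ∈ A ∪ B | f y = m} = {y ∈ A | f y = m} ∪ {y ∈ B | f y = m} :=
    Set.ext fun y => or_and_right
  rw [map_add, coeff_genFun, coeff_genFun, coeff_genFun, hunion,
    Set.ncard_union_eq (hAB.mono (fun y hy => hy.1) fun y hy => hy.1) (hfin A) (hfin B),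
    Nat.cast_add]

theorem genFun_univ_eq_sum {κ : Type*} [Fintype κ] {f : V → ℕ} (hf : ∀ m, {y | f y = m}.Finite)
    (A : κ → Set V) (hA : ∀ y, ∃! i, y ∈ A i) : genFun f Set.univ = ∑ i, genFun f (A i) := by
  classical
  choose g hg hgu using hA
  have hgA (y : V) (i : κ) : y ∈ A i ↔ g y = i :=
    ⟨fun hy => (hgu y i hy).symm, by rintro rfl; exact hg y⟩
  ext m
  have hcard (i : κ) : {y ∈ A i | f y = m}.ncard = ((hf m).toFinset.filter (g · = i)).card := by
    rw [← Set.ncard_coe_finset]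
    congr 1
    ext y
    simp [hgA, and_comm]
  have huniv : {y ∈ Set.univ | f y = m}.ncard = (hf m).toFinset.card := by
    rw [← Set.ncard_coe_finset]
    congr 1
    ext y
    simp
  simp only [map_sum, coeff_genFun, hcard, huniv]
  exact_mod_cast Finset.card_eq_sum_card_fiberwise fun y _ => Finset.mem_coe.2 (Finset.mem_univ _)

theorem genFun_vadd {f : V → ℕ} {A : Set V} {u : L} {e : ℕ}
    (hu : ∀ y ∈ A, f (u +ᵥ y) = f y + e) :
    genFun f (u +ᵥ A) = PowerSeries.X ^ e * genFun f A := by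
  ext m
  have himage : {y ∈ u +ᵥ A | f y = m} = u +ᵥ {y ∈ A | f y + e = m} := by
    ext y
    simp only [Set.mem_ofPred_eq, Set.mem_vadd_set_iff_neg_vadd_mem]
    refine and_congr_right fun hy => ?_
    rw [← hu _ hy, vadd_neg_vadd]
  rw [PowerSeries.coeff_X_pow_mul', coeff_genFun, himage, Set.ncard_vadd_set]
  split_ifs with hem
  · have hsub (y : V) : f y + e = m ↔ f y = m - e := by omega
    simp only [coeff_genFun, hsub]
  · have hempty : {y ∈ A | f y + e = m} = ∅ :=
      Set.eq_empty_of_forall_notMem fun y hy => hem (hy.2 ▸ Nat.le_add_left e (f y))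
    rw [hempty, Set.ncard_empty, Nat.cast_zero]

theorem one_sub_X_pow_mul_genFun {f : V → ℕ} (hf : ∀ m, {y | f y = m}.Finite) {A : Set V} {u : L}
    {e : ℕ} (huA : u +ᵥ A ⊆ A) (hu : ∀ y ∈ A, f (u +ᵥ y) = f y + e) :
    (1 - PowerSeries.X ^ e) * genFun f A = genFun f (A \ (u +ᵥ A)) := by
  rw [sub_mul, one_mul, ← genFun_vadd hu, sub_eq_iff_eq_add,
    ← genFun_union hf Set.disjoint_sdiff_left, Set.sdiff_union_of_subset huA]

theorem reflect_sum {R κ : Type*} [Semiring R] (N : ℕ) (t : Finset κ) (f : κ → R[X]) :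
    Polynomial.reflect N (∑ i ∈ t, f i) = ∑ i ∈ t, Polynomial.reflect N (f i) := by
  ext m
  simp only [Polynomial.coeff_reflect, Polynomial.finsetSum_coeff]

theorem exists_reflect_eq_genFun {f : V → ℕ} {B : Set V} (hB : B.Finite) {g : V → V}
    (hg : Function.Injective g) {e : ℕ} (hfg : ∀ y ∈ B, f y + f (g y) = e) :
    ∃ N : ℚ[X], N.natDegree ≤ e ∧ genFun f B = (N : ℚ⟦X⟧) ∧
      genFun f (g '' B) = (N.reflect e : ℚ⟦X⟧) := by
  classical
  refine ⟨∑ y ∈ hB.toFinset, Polynomial.X ^ f y, ?_, genFun_eq_sum hB, ?_⟩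
  · refine Polynomial.natDegree_sum_le_of_forall_le _ _ fun y hy => ?_
    rw [Polynomial.natDegree_X_pow]
    exact Nat.le.intro (hfg y (hB.mem_toFinset.1 hy))
  · have himage : (hB.image g).toFinset = hB.toFinset.image g := by
      ext y
      simp
    rw [genFun_eq_sum (hB.image g), himage, Finset.sum_image hg.injOn, reflect_sum]
    congr 1
    refine Finset.sum_congr rfl fun y hy => ?_
    have hy := hfg y (hB.mem_toFinset.1 hy)
    rw [Polynomial.reflect_monomial, Polynomial.revAt_le (Nat.le.intro hy), ← hy,
      Nat.add_sub_cancel_left]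

end GeneratingFunctions

section GeodesicCones

open scoped Pointwise

theorem linearCombination_indicator {ι L : Type*} [Fintype ι] [AddCommGroup L] (w : ι → L)
    (s : Finset ι) :
    Fintype.linearCombination ℕ w ((s : Set ι).indicator 1) = ∑ i ∈ s, w i := by
  classical
  simp [Fintype.linearCombination_apply, Set.indicator_apply, ite_smul]

theorem indicator_dotProduct {ι : Type*} [Fintype ι] (s : Finset ι) (d : ι → ℕ) :
    (s : Set ι).indicator 1 ⬝ᵥ d = ∑ i ∈ s, d i := by
  classical
  simp [dotProduct, Set.indicator_apply]

variable {L V ι : Type*} [AddCommGroup L] [AddAction L V] [DecidableEq ι] {c : V → ι → ℝ}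
  {w : ι → L} {d : ι → ℕ} {s : ι → Prop}

/-- The vertices in a half-open cone, where `s` tells which bounding hyperplanes belong to it. -/
def halfOpenCone (c : V → ι → ℝ) (s : ι → Prop) : Set V :=
  {y | ∀ i, c y i ∈ halfLine (s i)}

/-- The vertices in the part of a half-open cone which is cut off in the directions of `t`;
for `t = ∅` this is the cone, and if `t` contains all directions, it is a half-open box. -/
def halfOpenBox (c : V → ι → ℝ) (d : ι → ℕ) (s : ι → Prop) (t : Finset ι) : Set V :=
  {y ∈ halfOpenCone c s | ∀ i ∈ t, c y i - d i ∉ halfLine (s i)}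

theorem halfOpenBox_sdiff_vadd {i : ι} {t : Finset ι}
    (hc : ∀ y, c (w i +ᵥ y) = Pi.single i (d i : ℝ) + c y) (hit : i ∉ t) :
    halfOpenBox c d s t \ (w i +ᵥ halfOpenBox c d s t) = halfOpenBox c d s (insert i t) := by
  ext y
  have hy := hc (-w i +ᵥ y)
  rw [vadd_neg_vadd, ← sub_eq_iff_eq_add'] at hy
  have hyi : c (-w i +ᵥ y) i = c y i - d i := by simp [← hy]
  have hyj {j : ι} (hj : j ≠ i) : c (-w i +ᵥ y) j = c y j := by simp [← hy, hj]
  have hbox (hyt : y ∈ halfOpenBox c d s t) :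
      -w i +ᵥ y ∈ halfOpenBox c d s t ↔ c y i - d i ∈ halfLine (s i) := by
    refine ⟨fun h => hyi ▸ h.1 i, fun h => ⟨fun j => ?_, fun j hj => ?_⟩⟩
    · obtain rfl | hj := eq_or_ne j i
      · rwa [hyi]
      · rw [hyj hj]
        exact hyt.1 j
    · rw [hyj (ne_of_mem_of_not_mem hj hit)]
      exact hyt.2 j hj
  rw [Set.mem_sdiff, Set.mem_vadd_set_iff_neg_vadd_mem, and_congr_right fun h => not_congr (hbox h)]
  simp only [halfOpenBox, Set.mem_ofPred_eq, Finset.mem_insert, forall_eq_or_imp]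
  tauto

theorem prod_mul_genFun_halfOpenCone {f : V → ℕ} (hf : ∀ m, {y | f y = m}.Finite)
    (hc : ∀ i y, c (w i +ᵥ y) = Pi.single i (d i : ℝ) + c y)
    (hw : ∀ y ∈ halfOpenCone c s, ∀ i, f (w i +ᵥ y) = f y + d i) (t : Finset ι) :
    (∏ i ∈ t, (1 - PowerSeries.X ^ d i)) * genFun f (halfOpenCone c s) =
      genFun f (halfOpenBox c d s t) := by
  induction t using Finset.induction_on with
  | empty => simp [halfOpenBox]
  | insert i t hit ih =>
    have hle (y : V) : c y ≤ c (w i +ᵥ y) := by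
      rw [hc]
      exact le_add_of_nonneg_left (Pi.single_nonneg.2 (Nat.cast_nonneg (d i)))
    have heq (y : V) {j : ι} (hj : j ∈ t) : c (w i +ᵥ y) j = c y j := by
      rw [hc, Pi.add_apply, Pi.single_eq_of_ne (ne_of_mem_of_not_mem hj hit), zero_add]
    have hsub : w i +ᵥ halfOpenBox c d s t ⊆ halfOpenBox c d s t := by
      rintro _ ⟨y, hy, rfl⟩
      exact ⟨fun j => isUpperSet_halfLine _ (hle y j) (hy.1 j), fun j hj => by
        simpa only [heq y hj] using hy.2 j hj⟩
    rw [Finset.prod_insert hit, mul_assoc, ih,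
      one_sub_X_pow_mul_genFun hf hsub fun y hy => hw y hy.1 i, halfOpenBox_sdiff_vadd (hc i) hit]

theorem exists_nat_mul_le {r : ℝ} {k d : ℕ} (hd : 0 < d) (hr : 0 ≤ r) (hrk : r ≤ k * d) :
    ∃ m ≤ k, m * d ≤ r ∧ r < m * d + d ∧ (m = k → r = m * d) := by
  have hd : (0 : ℝ) < d := Nat.cast_pos.2 hd
  have hle : ⌊r / d⌋₊ * (d : ℝ) ≤ r :=
    (le_div_iff₀ hd).1 (Nat.floor_le (div_nonneg hr hd.le))
  have hlt : r < (⌊r / d⌋₊ + 1) * (d : ℝ) := (div_lt_iff₀ hd).1 (Nat.lt_floor_add_one _)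
  refine ⟨⌊r / d⌋₊, ?_, hle, by linarith, fun h => le_antisymm (h ▸ hrk) hle⟩
  exact_mod_cast le_of_mul_le_mul_right (hle.trans hrk) hd

variable [Fintype ι]

/-- Coordinates `c` with respect to a simplicial cone at `x₀` with generators `w i` of length `d i`
such that, for the distance `D`, the points of the cone lie on geodesics from `x₀` to the translates
of `x₀` along the generators. -/
structure IsGeodesicCone (D : V → V → ℕ) (x₀ : V) (c : V → ι → ℝ) (ρ : L →+ (ι → ℝ)) (w : ι → L)
    (d : ι → ℕ) : Prop where
  self : D x₀ x₀ = 0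
  triangle : ∀ x y z, D x z ≤ D x y + D y z
  comm : ∀ x y, D x y = D y x
  vadd : ∀ (u : L) x y, D (u +ᵥ x) (u +ᵥ y) = D x y
  pos : ∀ i, 0 < d i
  coord_base : c x₀ = 0
  coord_vadd : ∀ u y, c (u +ᵥ y) = ρ u + c y
  coord_generator : ∀ i, ρ (w i) = Pi.single i (d i : ℝ)
  lower : ∀ k : ι → ℕ, k ⬝ᵥ d ≤ D x₀ (Fintype.linearCombination ℕ w k +ᵥ x₀)
  box : ∀ (s : Finset ι) (y : V), (∀ i, 0 ≤ c y i ∧ c y i < d i) → (∀ i ∉ s, c y i = 0) →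
    D x₀ y + D y ((∑ i ∈ s, w i) +ᵥ x₀) = ∑ i ∈ s, d i

namespace IsGeodesicCone

variable {D : V → V → ℕ} {x₀ y : V} {ρ : L →+ (ι → ℝ)}

theorem coord_linearCombination (h : IsGeodesicCone D x₀ c ρ w d) (k : ι → ℕ) (j : ι) :
    ρ (Fintype.linearCombination ℕ w k) j = k j * d j := by
  simp [Fintype.linearCombination_apply, map_sum, h.coord_generator, Pi.single_apply]

theorem dist_generator (h : IsGeodesicCone D x₀ c ρ w d) (i : ι) : D x₀ (w i +ᵥ x₀) = d i := by
  simpa [h.self] using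
    h.box {i} x₀ (fun j => by simp [h.coord_base, h.pos]) fun j _ => by simp [h.coord_base]

theorem dist_add_le (h : IsGeodesicCone D x₀ c ρ w d) (u v : L) :
    D x₀ ((u + v) +ᵥ x₀) ≤ D x₀ (u +ᵥ x₀) + D x₀ (v +ᵥ x₀) := by
  refine (h.triangle x₀ (u +ᵥ x₀) _).trans (add_le_add le_rfl ?_)
  rw [add_vadd, h.vadd]

theorem dist_nsmul_le (h : IsGeodesicCone D x₀ c ρ w d) (m : ℕ) (i : ι) :
    D x₀ ((m • w i) +ᵥ x₀) ≤ m * d i := by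
  induction m with
  | zero => simp [h.self]
  | succ m ih =>
    rw [succ_nsmul, add_mul, one_mul]
    exact (h.dist_add_le _ _).trans (add_le_add ih (h.dist_generator i).le)

theorem upper (h : IsGeodesicCone D x₀ c ρ w d) (k : ι → ℕ) :
    D x₀ (Fintype.linearCombination ℕ w k +ᵥ x₀) ≤ k ⬝ᵥ d := by
  rw [Fintype.linearCombination_apply, dotProduct]
  induction (Finset.univ : Finset ι) using Finset.induction_on with
  | empty => simp [h.self]
  | insert i s his ih =>
    rw [Finset.sum_insert his, Finset.sum_insert his]
    exact (h.dist_add_le _ _).trans (add_le_add (h.dist_nsmul_le _ _) ih)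

theorem geodesic_of_eq_add (h : IsGeodesicCone D x₀ c ρ w d) {k m k' : ι → ℕ} {s : Finset ι}
    (hk : k = m + ((s : Set ι).indicator 1 + k'))
    (hy : ∀ i, m i * d i ≤ c y i ∧ c y i < m i * d i + d i) (hys : ∀ i ∉ s, c y i = m i * d i) :
    D x₀ y + D y (Fintype.linearCombination ℕ w k +ᵥ x₀) = k ⬝ᵥ d := by
  set u := Fintype.linearCombination ℕ w m
  obtain ⟨y, rfl⟩ : ∃ y', u +ᵥ y' = y := ⟨-u +ᵥ y, vadd_neg_vadd u y⟩
  have hcy (i : ι) : c (u +ᵥ y) i = m i * d i + c y i := by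
    rw [h.coord_vadd, Pi.add_apply, h.coord_linearCombination]
  simp only [hcy, le_add_iff_nonneg_right, add_lt_add_iff_left, add_eq_left] at hy hys
  have hbox := h.box s y hy hys
  have hlin : Fintype.linearCombination ℕ w k =
      u + (∑ i ∈ s, w i + Fintype.linearCombination ℕ w k') := by
    rw [hk, map_add, map_add, linearCombination_indicator]
  have hdot : k ⬝ᵥ d = m ⬝ᵥ d + (∑ i ∈ s, d i + k' ⬝ᵥ d) := by
    rw [hk, add_dotProduct, add_dotProduct, indicator_dotProduct]
  refine le_antisymm ?_ ((h.lower k).trans (h.triangle _ _ _))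
  have hfst : D x₀ (u +ᵥ y) ≤ m ⬝ᵥ d + D x₀ y := by
    refine (h.triangle _ (u +ᵥ x₀) _).trans (add_le_add (h.upper m) ?_)
    rw [h.vadd]
  have hsnd : D (u +ᵥ y) (Fintype.linearCombination ℕ w k +ᵥ x₀) ≤
      D y ((∑ i ∈ s, w i) +ᵥ x₀) + k' ⬝ᵥ d := by
    rw [hlin, add_vadd, h.vadd, add_vadd]
    refine (h.triangle _ ((∑ i ∈ s, w i) +ᵥ x₀) _).trans (add_le_add le_rfl ?_)
    rw [h.vadd]
    exact h.upper k'
  omega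

theorem geodesic (h : IsGeodesicCone D x₀ c ρ w d) {k : ι → ℕ}
    (hy : ∀ i, 0 ≤ c y i ∧ c y i ≤ k i * d i) :
    D x₀ y + D y (Fintype.linearCombination ℕ w k +ᵥ x₀) = k ⬝ᵥ d := by
  choose m hmk hle hlt heq using fun i => exists_nat_mul_le (h.pos i) (hy i).1 (hy i).2
  refine h.geodesic_of_eq_add (m := m) (s := {i | m i < k i})
    (k' := fun i => k i - m i - if m i < k i then 1 else 0) (funext fun i => ?_)
    (fun i => ⟨hle i, hlt i⟩) fun i hi => heq i ?_
  · have := hmk i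
    simp only [Pi.add_apply, Set.indicator_apply, Finset.mem_coe, Finset.mem_filter_univ,
      Pi.one_apply]
    split_ifs <;> omega
  · rw [Finset.mem_filter_univ, not_lt] at hi
    exact (hmk i).antisymm hi

theorem exists_bound (h : IsGeodesicCone D x₀ c ρ w d) (r : ι → ℝ) :
    ∃ k : ι → ℕ, ∀ i, r i ≤ k i * d i :=
  ⟨fun i => ⌈r i⌉₊, fun i => (Nat.le_ceil _).trans
    (le_mul_of_one_le_right (Nat.cast_nonneg _) (Nat.one_le_cast.2 (h.pos i)))⟩

theorem dist_vadd_of_nonneg (h : IsGeodesicCone D x₀ c ρ w d) (hy : 0 ≤ c y) (i : ι) :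
    D x₀ (w i +ᵥ y) = D x₀ y + d i := by
  obtain ⟨k, hk⟩ := h.exists_bound (c y)
  have hgeod := h.geodesic fun j => ⟨hy j, hk j⟩
  have hw : Fintype.linearCombination ℕ w (Pi.single i 1) = w i := by simp
  have hcy (j : ι) : c (w i +ᵥ y) j = (Pi.single i 1 : ι → ℕ) j * d j + c y j := by
    rw [← hw, h.coord_vadd, Pi.add_apply, h.coord_linearCombination]
  have hgeod' := h.geodesic (y := w i +ᵥ y) (k := Pi.single i 1 + k) fun j => by
    rw [hcy, Pi.add_apply, Nat.cast_add, add_mul]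
    exact ⟨add_nonneg (by positivity) (hy j), by gcongr; exact hk j⟩
  rw [map_add, hw, add_vadd, h.vadd, add_dotProduct, single_dotProduct, one_mul] at hgeod'
  omega

theorem neg (h : IsGeodesicCone D x₀ c ρ w d) : IsGeodesicCone D x₀ (-c) (-ρ) (-w) d where
  self := h.self
  triangle := h.triangle
  comm := h.comm
  vadd := h.vadd
  pos := h.pos
  coord_base := by simp [h.coord_base]
  coord_vadd u y := by
    rw [Pi.neg_apply, h.coord_vadd, neg_add, Pi.neg_apply, AddMonoidHom.neg_apply]
  coord_generator i := by simp [h.coord_generator]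
  lower k := by
    have hneg : Fintype.linearCombination ℕ (-w) k = -Fintype.linearCombination ℕ w k := by
      simp [Fintype.linearCombination_apply]
    rw [hneg, ← h.vadd (Fintype.linearCombination ℕ w k), vadd_neg_vadd, h.comm]
    exact h.lower k
  box s y hy hys := by
    set u := ∑ i ∈ s, w i
    have hu : Fintype.linearCombination ℕ w ((s : Set ι).indicator 1) = u :=
      linearCombination_indicator w s
    have hgeod := h.geodesic (y := u +ᵥ y) (k := (s : Set ι).indicator 1) fun i => by
      have := hy i
      have := hys i
      rw [← hu, h.coord_vadd, Pi.add_apply, h.coord_linearCombination, Set.indicator_apply]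
      simp only [Pi.neg_apply, neg_eq_zero] at *
      split_ifs with hi
      · simp only [Pi.one_apply, Nat.cast_one, one_mul]
        constructor <;> linarith
      · simp [this hi]
    have hneg : ∑ i ∈ s, (-w) i = -u := by simp [u]
    rw [hu, h.vadd, indicator_dotProduct] at hgeod
    rw [hneg, ← hgeod, add_comm, h.comm x₀ y, ← h.vadd u y, vadd_neg_vadd, h.comm]

theorem dist_box (h : IsGeodesicCone D x₀ c ρ w d) (hy : ∀ i, 0 ≤ c y i ∧ c y i ≤ d i) :
    D x₀ y + D x₀ (-(∑ i, w i) +ᵥ y) = ∑ i, d i := by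
  have hgeod := h.geodesic (k := 1) (by simpa using hy)
  rw [one_dotProduct, Fintype.linearCombination_apply] at hgeod
  simp only [Pi.one_apply, one_smul] at hgeod
  rw [← hgeod, h.comm _ (-(∑ i, w i) +ᵥ y), ← h.vadd (∑ i, w i) _ x₀, vadd_neg_vadd]

theorem prod_mul_genFun (h : IsGeodesicCone D x₀ c ρ w d) (hD : ∀ m, {y | D x₀ y = m}.Finite)
    (s : ι → Prop) : (∏ i, (1 - PowerSeries.X ^ d i)) * genFun (D x₀) (halfOpenCone c s) =
      genFun (D x₀) (halfOpenBox c d s Finset.univ) :=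
  prod_mul_genFun_halfOpenCone hD (fun i y => by rw [h.coord_vadd, h.coord_generator])
    (fun _ hy => h.dist_vadd_of_nonneg fun j => nonneg_of_mem_halfLine (hy j)) _

theorem image_halfOpenBox (h : IsGeodesicCone D x₀ c ρ w d) (s : ι → Prop) :
    (-(∑ i, w i) +ᵥ ·) '' halfOpenBox c d s Finset.univ =
      halfOpenBox (-c) d (fun i => ¬ s i) Finset.univ := by
  ext y
  have hcy (i : ι) : c ((∑ i, w i) +ᵥ y) i = c y i + d i := by
    simp [h.coord_vadd, h.coord_generator, Pi.single_apply, add_comm]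
  have hneg (i : ι) : -c y i - d i = -(c y i + d i) := by ring
  rw [Set.image_vadd, Set.mem_vadd_set_iff_neg_vadd_mem, neg_neg]
  simp only [halfOpenBox, halfOpenCone, Set.mem_ofPred_eq, Finset.mem_univ, forall_const,
    Pi.neg_apply, hcy, add_sub_cancel_right, hneg, neg_mem_halfLine_not_iff, not_not]
  exact and_comm

theorem exists_numerator (h : IsGeodesicCone D x₀ c ρ w d) (hD : ∀ m, {y | D x₀ y ≤ m}.Finite)
    (s : ι → Prop) :
    ∃ N : ℚ[X], N.natDegree ≤ ∑ i, d i ∧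
      (∏ i, (1 - PowerSeries.X ^ d i)) * genFun (D x₀) (halfOpenCone c s) = (N : ℚ⟦X⟧) ∧
      (∏ i, (1 - PowerSeries.X ^ d i)) * genFun (D x₀) (halfOpenCone (-c) fun i => ¬ s i) =
        (N.reflect (∑ i, d i) : ℚ⟦X⟧) := by
  have hD' (m : ℕ) : {y | D x₀ y = m}.Finite := (hD m).subset fun y => le_of_eq
  have hbox : ∀ y ∈ halfOpenBox c d s Finset.univ,
      D x₀ y + D x₀ (-(∑ i, w i) +ᵥ y) = ∑ i, d i := fun y hy => h.dist_box fun i =>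
    ⟨nonneg_of_mem_halfLine (hy.1 i), sub_nonpos.1
      (not_lt.1 fun hlt => hy.2 i (Finset.mem_univ i) (Or.inl hlt))⟩
  have hfin : (halfOpenBox c d s Finset.univ).Finite :=
    (hD _).subset fun y hy => Nat.le.intro (hbox y hy)
  rw [h.prod_mul_genFun hD', h.neg.prod_mul_genFun hD', ← h.image_halfOpenBox]
  exact exists_reflect_eq_genFun hfin (AddAction.injective _) hbox

end IsGeodesicCone

end GeodesicCones

/-! ### Rational functions and the substitution `t ↦ 1 / t` -/

section RationalFunctions

theorem isExpansion_algebraMap (p : ℚ[X]) :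
    IsExpansion (algebraMap ℚ[X] (RatFunc ℚ) p) (p : ℚ⟦X⟧) :=
  (RatFunc.coe_coe p).symm

theorem IsExpansion.sum {κ : Type*} {s : Finset κ} {R : κ → RatFunc ℚ} {F : κ → ℚ⟦X⟧}
    (h : ∀ k ∈ s, IsExpansion (R k) (F k)) : IsExpansion (∑ k ∈ s, R k) (∑ k ∈ s, F k) := by
  simp only [IsExpansion, map_sum] at h ⊢
  exact Finset.sum_congr rfl h

theorem IsExpansion.unique {R S : RatFunc ℚ} {G : ℚ⟦X⟧} (hR : IsExpansion R G)
    (hS : IsExpansion S G) : R = S :=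
  RingHom.injective _ (Eq.trans hR (Eq.symm hS))

theorem isExpansion_div_iff {R : RatFunc ℚ} {q : ℚ[X]} (hq : q ≠ 0) {F G : ℚ⟦X⟧}
    (hR : IsExpansion R F) :
    IsExpansion (R / algebraMap ℚ[X] (RatFunc ℚ) q) G ↔ (q : ℚ⟦X⟧) * G = F := by
  have hq' : HahnSeries.ofPowerSeries ℤ ℚ (q : ℚ⟦X⟧) ≠ 0 := by
    rw [Ne, map_eq_zero_iff _ HahnSeries.ofPowerSeries_injective]
    exact_mod_cast hq
  have hqe := isExpansion_algebraMap q
  simp only [IsExpansion] at hR hqe ⊢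
  rw [map_div₀, hR, hqe, div_eq_iff hq', ← map_mul, HahnSeries.ofPowerSeries_injective.eq_iff,
    mul_comm, eq_comm]

/-- The substitution `t ↦ 1 / t` on polynomials. -/
def evalInv : ℚ[X] →+* RatFunc ℚ := Polynomial.eval₂RingHom RatFunc.C (RatFunc.X)⁻¹

theorem evalInv_mul_X_pow {p : ℚ[X]} {N : ℕ} (hp : p.natDegree ≤ N) :
    evalInv p * RatFunc.X ^ N = algebraMap ℚ[X] (RatFunc ℚ) (p.reflect N) := by
  let _ : Invertible (RatFunc.X : RatFunc ℚ) := invertibleOfNonzero RatFunc.X_ne_zero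
  have h := Polynomial.eval₂_reflect_mul_pow (RatFunc.C : ℚ →+* RatFunc ℚ) RatFunc.X N
    (p.reflect N) (by simpa [hp] using Polynomial.natDegree_reflect_le (N := N) (p := p))
  rw [Polynomial.reflect_reflect, invOf_eq_inv] at h
  rw [evalInv, Polynomial.coe_eval₂RingHom, h, ← RatFunc.algebraMap_X, ← RatFunc.algebraMap_comp_C,
    ← Polynomial.hom_eval₂, Polynomial.eval₂_C_X]

theorem evalInv_injective : Function.Injective evalInv := by
  rw [injective_iff_map_eq_zero]
  intro p hp
  have h := evalInv_mul_X_pow (le_refl p.natDegree)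
  rw [hp, zero_mul, eq_comm, map_eq_zero_iff _ (RatFunc.algebraMap_injective ℚ)] at h
  simpa using h

/-- The substitution `t ↦ 1 / t` as a ring homomorphism. -/
def atInvHom : RatFunc ℚ →+* RatFunc ℚ :=
  RatFunc.liftRingHom evalInv (nonZeroDivisors_le_comap_nonZeroDivisors_of_injective _
    evalInv_injective)

theorem atInv_eq (R : RatFunc ℚ) : atInv R = atInvHom R := by
  rw [atInvHom, RatFunc.liftRingHom_apply]
  rfl

theorem atInvHom_algebraMap (p : ℚ[X]) :
    atInvHom (algebraMap ℚ[X] (RatFunc ℚ) p) = evalInv p :=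
  RatFunc.liftRingHom_algebraMap _ _ p

theorem atInv_div {p q : ℚ[X]} (hpq : p.natDegree ≤ q.natDegree) :
    atInv (algebraMap ℚ[X] (RatFunc ℚ) p / algebraMap ℚ[X] (RatFunc ℚ) q) =
      algebraMap ℚ[X] (RatFunc ℚ) (p.reflect q.natDegree) /
        algebraMap ℚ[X] (RatFunc ℚ) q.reverse := by
  rw [atInv_eq, map_div₀, atInvHom_algebraMap, atInvHom_algebraMap,
    ← mul_div_mul_right _ _ (pow_ne_zero q.natDegree RatFunc.X_ne_zero), evalInv_mul_X_pow hpq,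
    evalInv_mul_X_pow le_rfl, Polynomial.reverse]

theorem atInv_div_of_reverse_eq {p q : ℚ[X]} (hpq : p.natDegree ≤ q.natDegree) {n : ℕ}
    (hq : q.reverse = (-1) ^ n * q) :
    atInv (algebraMap ℚ[X] (RatFunc ℚ) p / algebraMap ℚ[X] (RatFunc ℚ) q) =
      (-1) ^ n * (algebraMap ℚ[X] (RatFunc ℚ) (p.reflect q.natDegree) /
        algebraMap ℚ[X] (RatFunc ℚ) q) := by
  rw [atInv_div hpq, hq, map_mul, map_pow, map_neg, map_one]
  rcases neg_one_pow_eq_or (RatFunc ℚ) n with hn | hn <;> simp [hn, div_neg]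

theorem one_sub_X_pow_ne_zero {e : ℕ} (he : 0 < e) : (1 - Polynomial.X ^ e : ℚ[X]) ≠ 0 := by
  rw [← neg_ne_zero, neg_sub]
  exact Polynomial.X_pow_sub_C_ne_zero he 1

theorem natDegree_one_sub_X_pow (e : ℕ) : (1 - Polynomial.X ^ e : ℚ[X]).natDegree = e := by
  rw [← Polynomial.natDegree_neg, neg_sub, ← Polynomial.C_1, Polynomial.natDegree_X_pow_sub_C]

theorem reverse_one_sub_X_pow (e : ℕ) :
    (1 - Polynomial.X ^ e : ℚ[X]).reverse = -(1 - Polynomial.X ^ e) := by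
  rw [Polynomial.reverse, natDegree_one_sub_X_pow, Polynomial.reflect_sub, Polynomial.reflect_one,
    Polynomial.reflect_monomial, Polynomial.revAt_le le_rfl, Nat.sub_self, pow_zero, neg_sub]

variable {ι : Type*} {s : Finset ι} {d : ι → ℕ}

theorem prod_one_sub_X_pow_ne_zero (hd : ∀ i ∈ s, 0 < d i) :
    (∏ i ∈ s, (1 - Polynomial.X ^ d i) : ℚ[X]) ≠ 0 :=
  Finset.prod_ne_zero_iff.2 fun i hi => one_sub_X_pow_ne_zero (hd i hi)

theorem natDegree_prod_one_sub_X_pow (hd : ∀ i ∈ s, 0 < d i) :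
    (∏ i ∈ s, (1 - Polynomial.X ^ d i) : ℚ[X]).natDegree = ∑ i ∈ s, d i := by
  rw [Polynomial.natDegree_prod _ _ fun i hi => one_sub_X_pow_ne_zero (hd i hi)]
  simp only [natDegree_one_sub_X_pow]

theorem reverse_prod_one_sub_X_pow (s : Finset ι) (d : ι → ℕ) :
    (∏ i ∈ s, (1 - Polynomial.X ^ d i) : ℚ[X]).reverse =
      (-1) ^ s.card * ∏ i ∈ s, (1 - Polynomial.X ^ d i) := by
  classical
  induction s using Finset.induction with
  | empty => simpa using Polynomial.reverse_C (1 : ℚ)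
  | insert i s hi ih =>
    rw [Finset.prod_insert hi, Polynomial.reverse_mul_of_domain, ih, reverse_one_sub_X_pow,
      Finset.card_insert_of_notMem hi]
    ring

theorem prod_one_sub_X_pow_dvd {K : ℕ} (hK : ∀ i ∈ s, d i ∣ K) :
    (∏ i ∈ s, (1 - Polynomial.X ^ d i) : ℚ[X]) ∣ (1 - Polynomial.X ^ K) ^ s.card := by
  rw [← Finset.prod_const]
  refine Finset.prod_dvd_prod_of_dvd _ _ fun i hi => ?_
  obtain ⟨m, rfl⟩ := hK i hi
  simpa only [one_pow, pow_mul] using sub_dvd_pow_sub_pow (1 : ℚ[X]) (Polynomial.X ^ d i) m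

theorem coe_prod_one_sub_X_pow (s : Finset ι) (d : ι → ℕ) :
    ((∏ i ∈ s, (1 - Polynomial.X ^ d i) : ℚ[X]) : ℚ⟦X⟧) = ∏ i ∈ s, (1 - PowerSeries.X ^ d i) := by
  rw [← Polynomial.coeToPowerSeries.ringHom_apply, map_prod]
  simp

end RationalFunctions

/-- The series `G` is the sum of the expansions of the rational functions `N_k / Q_k`, and also of
those of their reciprocals `(-1) ^ n * (N_k / Q_k)(1 / t)`, whose numerators are the reflections of
the `N_k` because the denominators are palindromic up to the sign `(-1) ^ n`. -/
structure IsReciprocalSum {κ : Type*} [Fintype κ] (G : ℚ⟦X⟧) (n : ℕ) (Q N : κ → ℚ[X]) : Prop where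
  ne_zero : ∀ k, Q k ≠ 0
  reverse_eq : ∀ k, (Q k).reverse = (-1) ^ n * Q k
  natDegree_le : ∀ k, (N k).natDegree ≤ (Q k).natDegree
  expansion : IsExpansion
    (∑ k, algebraMap ℚ[X] (RatFunc ℚ) (N k) / algebraMap ℚ[X] (RatFunc ℚ) (Q k)) G
  expansion_reflect : IsExpansion
    (∑ k, algebraMap ℚ[X] (RatFunc ℚ) ((N k).reflect (Q k).natDegree) /
      algebraMap ℚ[X] (RatFunc ℚ) (Q k)) G

theorem IsLCM.exists_range {κ : Type*} [Finite κ] {Q : κ → ℚ[X]} (hQ : ∀ k, Q k ≠ 0) :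
    ∃ P, P ≠ 0 ∧ IsLCM (Set.range Q) P := by
  have := Fintype.ofFinite κ
  let _ := UniqueFactorizationMonoid.toNormalizedGCDMonoid ℚ[X]
  refine ⟨Finset.univ.lcm Q, ?_, ?_, ?_⟩
  · simpa [Finset.lcm_eq_zero_iff] using hQ
  · exact Set.forall_mem_range.2 fun k => Finset.dvd_lcm (Finset.mem_univ k)
  · exact fun R hR => Finset.lcm_dvd fun k _ => hR _ (Set.mem_range_self k)

namespace IsReciprocalSum

variable {κ : Type*} [Fintype κ] {G : ℚ⟦X⟧} {n : ℕ} {Q N : κ → ℚ[X]}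

theorem atInv_eq_of_isExpansion (h : IsReciprocalSum G n Q N) {R : RatFunc ℚ}
    (hR : IsExpansion R G) : atInv R = (-1) ^ n * R := by
  calc atInv R = ∑ k, atInv (algebraMap ℚ[X] (RatFunc ℚ) (N k) / algebraMap ℚ[X] _ (Q k)) := by
        rw [hR.unique h.expansion]
        simp only [atInv_eq, map_sum]
    _ = ∑ k, (-1) ^ n * (algebraMap ℚ[X] (RatFunc ℚ) ((N k).reflect (Q k).natDegree) /
          algebraMap ℚ[X] _ (Q k)) :=
        Finset.sum_congr rfl fun k _ =>
          atInv_div_of_reverse_eq (h.natDegree_le k) (h.reverse_eq k)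
    _ = (-1) ^ n * R := by rw [← Finset.mul_sum, hR.unique h.expansion_reflect]

theorem exists_numerator (h : IsReciprocalSum G n Q N) {P : ℚ[X]} (hP : P ≠ 0)
    (hQP : ∀ k, Q k ∣ P) : ∃ A : ℚ[X], A.natDegree ≤ P.natDegree ∧
      IsExpansion (algebraMap ℚ[X] (RatFunc ℚ) A / algebraMap ℚ[X] (RatFunc ℚ) P) G := by
  choose M hM using hQP
  have hM0 : ∀ k, M k ≠ 0 := fun k hk => hP (by rw [hM k, hk, mul_zero])
  refine ⟨∑ k, N k * M k, Polynomial.natDegree_sum_le_of_forall_le _ _ fun k _ => ?_, ?_⟩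
  · rw [hM k, Polynomial.natDegree_mul (h.ne_zero k) (hM0 k)]
    exact Polynomial.natDegree_mul_le.trans (by gcongr; exact h.natDegree_le k)
  · convert h.expansion using 1
    rw [map_sum, Finset.sum_div]
    refine Finset.sum_congr rfl fun k _ => ?_
    rw [hM k, map_mul, map_mul,
      mul_div_mul_right _ _ (RatFunc.algebraMap_ne_zero (hM0 k))]

theorem exists_isLCM (h : IsReciprocalSum G n Q N) :
    ∃ Q₁ Q₂ : ℚ[X], IsLCM (Set.range Q) Q₂ ∧ Q₁.degree ≤ Q₂.degree ∧
      IsExpansion (algebraMap ℚ[X] (RatFunc ℚ) Q₁ / algebraMap ℚ[X] (RatFunc ℚ) Q₂) G := by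
  obtain ⟨P, hP, hlcm⟩ := IsLCM.exists_range h.ne_zero
  obtain ⟨A, hA, hexp⟩ := h.exists_numerator hP fun k => hlcm.1 _ (Set.mem_range_self k)
  have hdeg : A.degree ≤ P.degree :=
    (Polynomial.degree_le_of_natDegree_le hA).trans_eq (Polynomial.degree_eq_natDegree hP).symm
  exact ⟨A, P, hlcm, hdeg, hexp⟩

theorem exists_ratFunc (h : IsReciprocalSum G n Q N) {B : ℚ⟦X⟧}
    (hB : (1 - PowerSeries.X) * B = G) :
    ∃ Rb Rs : RatFunc ℚ, IsExpansion Rb B ∧ IsExpansion Rs G ∧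
      atInv Rb = (-1) ^ (n + 1) * RatFunc.X * Rb ∧ atInv Rs = (-1) ^ n * Rs := by
  have hX := RatFunc.X_ne_zero (K := ℚ)
  have hX1 : (1 - Polynomial.X : ℚ[X]) ≠ 0 := by simpa using one_sub_X_pow_ne_zero one_pos
  refine ⟨_, _, (isExpansion_div_iff hX1 h.expansion).2 (by simpa using hB), h.expansion, ?_,
    h.atInv_eq_of_isExpansion h.expansion⟩
  have hinv : evalInv (1 - Polynomial.X) =
      -algebraMap ℚ[X] (RatFunc ℚ) (1 - Polynomial.X) / RatFunc.X := by
    simp only [evalInv, map_sub, map_one, Polynomial.coe_eval₂RingHom, Polynomial.eval₂_X,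
      RatFunc.algebraMap_X]
    field_simp
    ring
  rw [atInv_eq, map_div₀, ← atInv_eq, h.atInv_eq_of_isExpansion h.expansion, atInvHom_algebraMap,
    hinv, pow_succ]
  field_simp

theorem exists_palindromic_numerator (h : IsReciprocalSum G n Q N) {K : ℕ} (hK : 0 < K)
    (hQK : ∀ k, Q k ∣ (1 - Polynomial.X ^ K) ^ n) : ∃ A : ℚ[X], A.natDegree ≤ K * n ∧
      A.reflect (K * n) = A ∧ (1 - PowerSeries.X ^ K) ^ n * G = (A : ℚ⟦X⟧) := by
  have hP : ((1 - Polynomial.X ^ K) ^ n : ℚ[X]) ≠ 0 := pow_ne_zero _ (one_sub_X_pow_ne_zero hK)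
  have hdeg : ((1 - Polynomial.X ^ K) ^ n : ℚ[X]).natDegree = K * n := by
    rw [Polynomial.natDegree_pow, natDegree_one_sub_X_pow, mul_comm]
  have hrev : ((1 - Polynomial.X ^ K) ^ n : ℚ[X]).reverse =
      (-1) ^ n * (1 - Polynomial.X ^ K) ^ n := by
    simpa using reverse_prod_one_sub_X_pow (Finset.range n) fun _ => K
  obtain ⟨A, hA, hexp⟩ := h.exists_numerator hP hQK
  refine ⟨A, hdeg ▸ hA, ?_, ?_⟩
  · have hinv := h.atInv_eq_of_isExpansion hexp
    rw [atInv_div_of_reverse_eq hA hrev, hdeg] at hinv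
    have hinv := mul_left_cancel₀ (pow_ne_zero n (neg_ne_zero.2 one_ne_zero)) hinv
    exact RatFunc.algebraMap_injective ℚ ((div_left_inj' (RatFunc.algebraMap_ne_zero hP)).1 hinv)
  · simpa using (isExpansion_div_iff hP (isExpansion_algebraMap A)).1 hexp

theorem exists_palindromic_numerator_cumulative (h : IsReciprocalSum G n Q N) {B : ℚ⟦X⟧}
    (hB : (1 - PowerSeries.X) * B = G) {K : ℕ} (hK : 0 < K)
    (hQK : ∀ k, Q k ∣ (1 - Polynomial.X ^ K) ^ n) :
    ∃ A : ℚ[X], A.natDegree ≤ K * (n + 1) - 1 ∧ A.reflect (K * (n + 1) - 1) = A ∧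
      (1 - PowerSeries.X ^ K) ^ (n + 1) * B = (A : ℚ⟦X⟧) := by
  obtain ⟨A, hdeg, hrefl, hA⟩ := h.exists_palindromic_numerator hK hQK
  set q : ℚ[X] := ∑ i ∈ Finset.range K, Polynomial.X ^ i
  have hq : (1 - Polynomial.X) * q = 1 - Polynomial.X ^ K := mul_neg_geom_sum _ _
  have hqdeg : q.natDegree ≤ K - 1 :=
    Polynomial.natDegree_sum_le_of_forall_le _ _ fun i hi => by
      have := Finset.mem_range.1 hi
      rw [Polynomial.natDegree_X_pow]
      omega
  have hqrefl : q.reflect (K - 1) = q := by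
    rw [reflect_sum, ← Finset.sum_range_reflect]
    refine Finset.sum_congr rfl fun i hi => ?_
    have := Finset.mem_range.1 hi
    rw [Polynomial.reflect_monomial, Polynomial.revAt_le (by omega)]
    congr 1
    omega
  have hKn : K * (n + 1) - 1 = K * n + (K - 1) := by rw [mul_add, mul_one]; omega
  refine ⟨A * q, ?_, ?_, ?_⟩
  · rw [hKn]
    exact Polynomial.natDegree_mul_le.trans (add_le_add hdeg hqdeg)
  · rw [hKn, Polynomial.reflect_mul _ _ hdeg hqdeg, hrefl, hqrefl]
  · have hqs : (1 - PowerSeries.X) * (q : ℚ⟦X⟧) = 1 - PowerSeries.X ^ K := by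
      simpa using congrArg (fun p : ℚ[X] => (p : ℚ⟦X⟧)) hq
    rw [Polynomial.coe_mul, ← hA, ← hB, pow_succ, ← hqs]
    ring

end IsReciprocalSum

/-! ### Quasi-polynomials -/

section QuasiPolynomials

theorem isQuasiPolynomial_iff {f : ℤ → ℂ} : IsQuasiPolynomial f ↔
    ∃ N : ℕ, 0 < N ∧ ∀ r : ℤ, ∃ q : ℂ[X], ∀ m : ℤ, m ≡ r [ZMOD N] → f m = q.eval (m : ℂ) := by
  constructor
  · rintro ⟨N, hN, Q, hQ⟩
    refine ⟨N, hN, fun r => ?_⟩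
    have hN' : (0 : ℤ) < N := by exact_mod_cast hN
    have hnonneg := Int.emod_nonneg r hN'.ne'
    have hlt := Int.emod_lt_of_pos r hN'
    refine ⟨Q ⟨(r % N).toNat, by omega⟩, fun m hm => hQ _ m ?_⟩
    simpa only [Int.toNat_of_nonneg hnonneg] using hm.trans (Int.mod_modEq r N).symm
  · rintro ⟨N, hN, h⟩
    choose Q hQ using h
    exact ⟨N, hN, fun i => Q i, fun i m hm => hQ i m hm⟩

theorem IsQuasiPolynomial.add {f g : ℤ → ℂ} (hf : IsQuasiPolynomial f)
    (hg : IsQuasiPolynomial g) : IsQuasiPolynomial fun i => f i + g i := by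
  rw [isQuasiPolynomial_iff] at *
  obtain ⟨N, hN, hf⟩ := hf
  obtain ⟨N', hN', hg⟩ := hg
  refine ⟨N * N', Nat.mul_pos hN hN', fun r => ?_⟩
  obtain ⟨p, hp⟩ := hf r
  obtain ⟨q, hq⟩ := hg r
  refine ⟨p + q, fun m hm => ?_⟩
  push_cast at hm
  rw [hp m (Int.ModEq.of_mul_right _ hm), hq m (Int.ModEq.of_mul_left _ hm), Polynomial.eval_add]

theorem IsQuasiPolynomial.const_mul {f : ℤ → ℂ} (c : ℂ) (hf : IsQuasiPolynomial f) :
    IsQuasiPolynomial fun i => c * f i := by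
  rw [isQuasiPolynomial_iff] at *
  obtain ⟨N, hN, hf⟩ := hf
  refine ⟨N, hN, fun r => ?_⟩
  obtain ⟨p, hp⟩ := hf r
  exact ⟨Polynomial.C c * p, fun m hm => by rw [hp m hm, Polynomial.eval_C_mul]⟩

theorem IsQuasiPolynomial.sub {f g : ℤ → ℂ} (hf : IsQuasiPolynomial f)
    (hg : IsQuasiPolynomial g) : IsQuasiPolynomial fun i => f i - g i := by
  simpa only [neg_one_mul, ← sub_eq_add_neg] using hf.add (hg.const_mul (-1))

theorem isQuasiPolynomial_zero : IsQuasiPolynomial fun _ => 0 :=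
  isQuasiPolynomial_iff.2 ⟨1, one_pos, fun _ => ⟨0, fun _ _ => Polynomial.eval_zero.symm⟩⟩

theorem IsQuasiPolynomial.sum {κ : Type*} {s : Finset κ} {f : κ → ℤ → ℂ}
    (hf : ∀ k, IsQuasiPolynomial (f k)) : IsQuasiPolynomial fun i => ∑ k ∈ s, f k i := by
  classical
  induction s using Finset.induction with
  | empty => simpa only [Finset.sum_empty] using isQuasiPolynomial_zero
  | insert k s hk ih => simpa only [Finset.sum_insert hk] using (hf k).add ih

theorem IsQuasiPolynomial.comp_sub {f : ℤ → ℂ} (hf : IsQuasiPolynomial f) (c : ℤ) :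
    IsQuasiPolynomial fun i => f (i - c) := by
  rw [isQuasiPolynomial_iff] at *
  obtain ⟨N, hN, hf⟩ := hf
  refine ⟨N, hN, fun r => ?_⟩
  obtain ⟨p, hp⟩ := hf (r - c)
  refine ⟨p.comp (Polynomial.X - Polynomial.C (c : ℂ)), fun m hm => ?_⟩
  rw [hp (m - c) (hm.sub_right c)]
  simp

theorem IsQuasiPolynomial.eq_zero {f : ℤ → ℂ} (hf : IsQuasiPolynomial f) {M : ℕ}
    (h : ∀ i : ℕ, M < i → f i = 0) : f = 0 := by
  rw [isQuasiPolynomial_iff] at hf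
  obtain ⟨N, hN, hf⟩ := hf
  ext r
  obtain ⟨p, hp⟩ := hf r
  have hN' : (0 : ℤ) < N := by exact_mod_cast hN
  have hroot : ∀ m : ℤ, m ≡ r [ZMOD N] → (M : ℤ) < m → p.IsRoot (m : ℂ) := by
    intro m hm hMm
    lift m to ℕ using by omega
    rw [Polynomial.IsRoot, ← hp m hm]
    exact h m (by exact_mod_cast hMm)
  have hinj : Function.Injective fun t : ℕ => ((r + N * (r.natAbs + M + 1 + t : ℕ) : ℤ) : ℂ) := by
    intro a b hab
    have := mul_left_cancel₀ hN'.ne' (add_left_cancel (Int.cast_injective hab))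
    omega
  have hp0 : p = 0 := by
    refine Polynomial.eq_zero_of_infinite_isRoot p
      ((Set.infinite_range_of_injective hinj).mono ?_)
    rintro _ ⟨t, rfl⟩
    refine hroot _ (by simp [Int.ModEq]) ?_
    have : ((r.natAbs + M + 1 + t : ℕ) : ℤ) ≤ N * (r.natAbs + M + 1 + t : ℕ) :=
      le_mul_of_one_le_left (by positivity) hN'
    omega
  rw [hp r rfl, hp0, Polynomial.eval_zero, Pi.zero_apply]

theorem IsQuasiPolynomialOf.unique {f f' : ℤ → ℂ} {g : ℕ → ℕ} (hf : IsQuasiPolynomialOf f g)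
    (hf' : IsQuasiPolynomialOf f' g) : f = f' := by
  obtain ⟨h, M, hM⟩ := hf
  obtain ⟨h', M', hM'⟩ := hf'
  refine sub_eq_zero.1 ((h.sub h').eq_zero (M := max M M') fun i hi => ?_)
  rw [← hM i ((le_max_left _ _).trans_lt hi), ← hM' i ((le_max_right _ _).trans_lt hi), sub_self]

/-- The quasi-polynomial on `ℤ` which extends the coefficients of `1 / (1 - t ^ K) ^ (n + 1)`. -/
def chooseQuasiPolynomial (K n : ℕ) (m : ℤ) : ℂ :=
  if (K : ℤ) ∣ m then (Polynomial.preHilbertPoly ℂ n 0).eval ((m : ℂ) / K) else 0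

theorem eval_preHilbertPoly (n : ℕ) (x : ℂ) : (Polynomial.preHilbertPoly ℂ n 0).eval x =
    (n.factorial : ℂ)⁻¹ * (ascPochhammer ℂ n).eval (x + 1) := by
  simp [Polynomial.preHilbertPoly]

theorem chooseQuasiPolynomial_mul {K : ℕ} (hK : 0 < K) (n : ℕ) (m : ℤ) :
    chooseQuasiPolynomial K n (K * m) = (Polynomial.preHilbertPoly ℂ n 0).eval (m : ℂ) := by
  have hK' : (K : ℂ) ≠ 0 := by exact_mod_cast hK.ne'
  rw [chooseQuasiPolynomial, if_pos (dvd_mul_right _ _), Int.cast_mul, Int.cast_natCast,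
    mul_div_cancel_left₀ _ hK']

theorem isQuasiPolynomial_chooseQuasiPolynomial {K : ℕ} (hK : 0 < K) (n : ℕ) :
    IsQuasiPolynomial (chooseQuasiPolynomial K n) := by
  refine isQuasiPolynomial_iff.2 ⟨K, hK, fun r => ⟨if (K : ℤ) ∣ r then
    (Polynomial.preHilbertPoly ℂ n 0).comp (Polynomial.C (K : ℂ)⁻¹ * Polynomial.X) else 0,
    fun m hm => ?_⟩⟩
  simp only [chooseQuasiPolynomial, hm.dvd_iff]
  split_ifs <;> simp [div_eq_inv_mul]

theorem one_sub_X_pow_mul_mk_chooseQuasiPolynomial {K : ℕ} (hK : 0 < K) (n : ℕ) :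
    (1 - PowerSeries.X ^ K) ^ (n + 1) *
      PowerSeries.mk (fun i : ℕ => chooseQuasiPolynomial K n i) = 1 := by
  have hexpand : PowerSeries.mk (fun i : ℕ => chooseQuasiPolynomial K n i) =
      PowerSeries.expand K hK.ne' (PowerSeries.mk fun i => ((n + i).choose n : ℂ)) := by
    ext i
    rw [PowerSeries.coeff_expand, PowerSeries.coeff_mk]
    split_ifs with hi
    · obtain ⟨k, rfl⟩ := hi
      rw [PowerSeries.coeff_mk, Nat.mul_div_cancel_left _ hK, Nat.cast_mul,
        chooseQuasiPolynomial_mul hK, Int.cast_natCast,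
        Polynomial.preHilbertPoly_eq_choose_sub_add ℂ n (Nat.zero_le k), Nat.sub_zero, add_comm]
    · rw [chooseQuasiPolynomial, if_neg (by exact_mod_cast hi)]
  have h := congrArg (PowerSeries.expand K hK.ne')
    (PowerSeries.mk_add_choose_mul_one_sub_pow_eq_one ℂ n)
  rwa [map_mul, map_pow, map_sub, map_one, PowerSeries.expand_X, ← hexpand, mul_comm] at h

theorem chooseQuasiPolynomial_eq_zero {K n : ℕ} {m : ℤ} (hm : m < 0) (hm' : -(K * (n + 1)) < m) :
    chooseQuasiPolynomial K n m = 0 := by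
  by_cases hdvd : (K : ℤ) ∣ m
  · obtain ⟨k, rfl⟩ := hdvd
    have hK : 0 < K := Nat.pos_of_ne_zero (by rintro rfl; simp at hm)
    have hK' : (0 : ℤ) < K := by exact_mod_cast hK
    have hk : k < 0 := by nlinarith [hK']
    have hk' : -(n + 1 : ℤ) < k := by nlinarith [hK']
    obtain ⟨r, rfl⟩ : ∃ r : ℕ, k = -(r : ℤ) - 1 := ⟨(-k - 1).toNat, by omega⟩
    rw [chooseQuasiPolynomial_mul hK, eval_preHilbertPoly]
    push_cast
    rw [sub_add_cancel, ascPochhammer_eval_neg_coe_nat_of_lt (by omega), mul_zero]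
  · rw [chooseQuasiPolynomial, if_neg hdvd]

theorem chooseQuasiPolynomial_neg_sub {K : ℕ} (hK : 0 < K) (n : ℕ) (m : ℤ) :
    chooseQuasiPolynomial K n (-m - K * (n + 1)) = (-1) ^ n * chooseQuasiPolynomial K n m := by
  by_cases hdvd : (K : ℤ) ∣ m
  · obtain ⟨k, rfl⟩ := hdvd
    rw [show -(K * k) - K * (n + 1) = (K : ℤ) * (-k - (n + 1)) by ring,
      chooseQuasiPolynomial_mul hK, chooseQuasiPolynomial_mul hK, eval_preHilbertPoly,
      eval_preHilbertPoly]
    push_cast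
    rw [show (-k - (n + 1) + 1 : ℂ) = -(k + n) by ring, ascPochhammer_eval_neg_eq_descPochhammer,
      descPochhammer_eval_eq_ascPochhammer, add_sub_cancel_right]
    ring
  · have hdvd' : ¬ (K : ℤ) ∣ -m - K * (n + 1) := by
      rwa [dvd_sub_left (dvd_mul_right _ _), dvd_neg]
    rw [chooseQuasiPolynomial, chooseQuasiPolynomial, if_neg hdvd, if_neg hdvd', mul_zero]

/-- The quasi-polynomial on `ℤ` which extends the coefficients of `A / (1 - t ^ K) ^ (n + 1)`, for
`A` of degree less than `K * (n + 1)`. -/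
def coeffQuasiPolynomial (K n : ℕ) (A : ℚ[X]) (i : ℤ) : ℂ :=
  ∑ j ∈ Finset.range (K * (n + 1)), (A.coeff j : ℂ) * chooseQuasiPolynomial K n (i - j)

theorem isQuasiPolynomial_coeffQuasiPolynomial {K : ℕ} (hK : 0 < K) (n : ℕ) (A : ℚ[X]) :
    IsQuasiPolynomial (coeffQuasiPolynomial K n A) :=
  IsQuasiPolynomial.sum fun j =>
    ((isQuasiPolynomial_chooseQuasiPolynomial hK n).comp_sub (j : ℤ)).const_mul (A.coeff j : ℂ)

theorem coeff_eq_coeffQuasiPolynomial {K : ℕ} (hK : 0 < K) {n : ℕ} {A : ℚ[X]}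
    (hA : A.natDegree < K * (n + 1)) {B : ℚ⟦X⟧}
    (hB : (1 - PowerSeries.X ^ K) ^ (n + 1) * B = (A : ℚ⟦X⟧)) (i : ℕ) :
    ((PowerSeries.coeff i B : ℚ) : ℂ) = coeffQuasiPolynomial K n A i := by
  set β : PowerSeries ℂ := PowerSeries.mk fun i : ℕ => chooseQuasiPolynomial K n i with hβ
  have hB' : (1 - PowerSeries.X ^ K) ^ (n + 1) * B.map (algebraMap ℚ ℂ) =
      (A.map (algebraMap ℚ ℂ) : PowerSeries ℂ) := by
    simpa using congrArg (PowerSeries.map (algebraMap ℚ ℂ)) hB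
  have hBβ : B.map (algebraMap ℚ ℂ) = (A.map (algebraMap ℚ ℂ) : PowerSeries ℂ) * β := by
    rw [← hB', mul_right_comm, one_sub_X_pow_mul_mk_chooseQuasiPolynomial hK, one_mul]
  have hsum : (A.map (algebraMap ℚ ℂ) : PowerSeries ℂ) =
      ∑ j ∈ Finset.range (K * (n + 1)), PowerSeries.C (A.coeff j : ℂ) * PowerSeries.X ^ j := by
    conv_lhs => rw [A.as_sum_range' _ hA]
    rw [← Polynomial.coeToPowerSeries.ringHom_apply, ← Polynomial.coe_mapRingHom, map_sum, map_sum]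
    simp [← Polynomial.C_mul_X_pow_eq_monomial]
  calc ((PowerSeries.coeff i B : ℚ) : ℂ) = PowerSeries.coeff i (B.map (algebraMap ℚ ℂ)) := by simp
    _ = ∑ j ∈ Finset.range (K * (n + 1)), (A.coeff j : ℂ) *
          if j ≤ i then chooseQuasiPolynomial K n (i - j : ℕ) else 0 := by
        rw [hBβ, hsum, Finset.sum_mul, map_sum]
        simp only [mul_assoc, PowerSeries.coeff_C_mul, PowerSeries.coeff_X_pow_mul', hβ,
          PowerSeries.coeff_mk]
    _ = coeffQuasiPolynomial K n A i := by
        refine Finset.sum_congr rfl fun j hj => ?_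
        have hj := Finset.mem_range.1 hj
        split_ifs with hji
        · rw [Nat.cast_sub hji]
        · rw [chooseQuasiPolynomial_eq_zero (by omega)]
          zify at hj
          omega

theorem coeffQuasiPolynomial_neg {K : ℕ} (hK : 0 < K) {n : ℕ} {A : ℚ[X]}
    (hA : A.reflect (K * (n + 1) - 1) = A) (i : ℤ) :
    coeffQuasiPolynomial K n A (-i) = (-1) ^ n * coeffQuasiPolynomial K n A (i - 1) := by
  rw [coeffQuasiPolynomial, coeffQuasiPolynomial, ← Finset.sum_range_reflect, Finset.mul_sum]
  refine Finset.sum_congr rfl fun j hj => ?_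
  have hj := Finset.mem_range.1 hj
  have hcoeff : A.coeff (K * (n + 1) - 1 - j) = A.coeff j := by
    conv_rhs => rw [← hA, Polynomial.coeff_reflect, Polynomial.revAt_le (by omega)]
  have harg : -i - ((K * (n + 1) - 1 - j : ℕ) : ℤ) = -(i - 1 - j) - K * (n + 1) := by
    rw [Nat.sub_sub, Nat.cast_sub (by omega)]
    push_cast
    ring
  rw [hcoeff, harg, chooseQuasiPolynomial_neg_sub hK]
  ring

namespace IsReciprocalSum

variable {κ : Type*} [Fintype κ] {G : ℚ⟦X⟧} {n : ℕ} {Q N : κ → ℚ[X]} {b s : ℕ → ℕ} {K : ℕ}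

theorem exists_isQuasiPolynomial_cumulative (h : IsReciprocalSum G n Q N)
    (hb : (1 - PowerSeries.X) * PowerSeries.mk (fun i => (b i : ℚ)) = G) (hK : 0 < K)
    (hQK : ∀ k, Q k ∣ (1 - Polynomial.X ^ K) ^ n) :
    ∃ f, IsQuasiPolynomial f ∧ (∀ i : ℕ, (b i : ℂ) = f i) ∧
      ∀ i, f (-i) = (-1) ^ n * f (i - 1) := by
  obtain ⟨A, hdeg, hrefl, hA⟩ := h.exists_palindromic_numerator_cumulative hb hK hQK
  have hlt : A.natDegree < K * (n + 1) :=
    hdeg.trans_lt (Nat.sub_lt (Nat.mul_pos hK n.succ_pos) one_pos)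
  refine ⟨coeffQuasiPolynomial K n A, isQuasiPolynomial_coeffQuasiPolynomial hK n A, fun i => ?_,
    coeffQuasiPolynomial_neg hK hrefl⟩
  rw [← coeff_eq_coeffQuasiPolynomial hK hlt hA, PowerSeries.coeff_mk, Rat.cast_natCast]

theorem exists_isQuasiPolynomial (h : IsReciprocalSum G n Q N)
    (hb : (1 - PowerSeries.X) * PowerSeries.mk (fun i => (b i : ℚ)) = G)
    (hs : PowerSeries.mk (fun i => (s i : ℚ)) = G) (hK : 0 < K)
    (hQK : ∀ k, Q k ∣ (1 - Polynomial.X ^ K) ^ n) :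
    ∃ f, IsQuasiPolynomial f ∧ (∀ i : ℕ, 1 ≤ i → (s i : ℂ) = f i) ∧
      ∀ i, f (-i) = (-1) ^ (n + 1) * f i := by
  obtain ⟨f, hf, hbf, hneg⟩ := h.exists_isQuasiPolynomial_cumulative hb hK hQK
  refine ⟨fun i => f i - f (i - 1), hf.sub (hf.comp_sub 1), fun i hi => ?_, fun i => ?_⟩
  · obtain ⟨i, rfl⟩ := Nat.exists_eq_add_of_le' hi
    have hcoeff := congrArg (PowerSeries.coeff (i + 1)) (hb.trans hs.symm)
    rw [sub_mul, one_mul, map_sub, PowerSeries.coeff_succ_X_mul] at hcoeff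
    simp only [PowerSeries.coeff_mk] at hcoeff
    have hdiff : (s (i + 1) : ℂ) = b (i + 1) - b i := by exact_mod_cast hcoeff.symm
    simp [hdiff, hbf]
  · beta_reduce
    rw [← neg_add', hneg i, hneg (i + 1), add_sub_cancel_right]
    ring

end IsReciprocalSum

end QuasiPolynomials

/-! ### The growth series of a well-arranged periodic graph -/

section Growth

open Module

namespace FacetTriangulation

variable {V W : Type*} [AddCommGroup W] [Module ℝ W] [Nontrivial W] {S : Finset W}
  {T : Set W → Finset (Finset W)} {ξ : W} {f : V → ℕ}

theorem genFun_univ_eq_sum [Fintype (simplices S T)] (h : FacetTriangulation S T)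
    (hξ : Generic (S : Set W) ξ) (hf : ∀ m, {y | f y = m}.Finite) (P : V → W) :
    genFun f Set.univ = ∑ Δ : simplices S T, genFun f (halfOpenCone
      (fun y => (h.basis Δ.2).equivFun (P y)) fun v => 0 < (h.basis Δ.2).repr ξ v) :=
  PeriodicGrowth.genFun_univ_eq_sum hf _ fun y => h.existsUnique_halfOpen hξ (P y)

theorem genFun_univ_eq_sum_neg [Fintype (simplices S T)] (h : FacetTriangulation S T)
    (hξ : Generic (S : Set W) ξ) (hf : ∀ m, {y | f y = m}.Finite) (P : V → W) :
    genFun f Set.univ = ∑ Δ : simplices S T, genFun f (halfOpenCone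
      (-fun y => (h.basis Δ.2).equivFun (P y)) fun v => ¬ 0 < (h.basis Δ.2).repr ξ v) := by
  refine PeriodicGrowth.genFun_univ_eq_sum hf _ fun y => ?_
  exact (existsUnique_congr fun Δ => h.halfOpen_neg_iff hξ Δ.2).1
    (h.existsUnique_halfOpen hξ.neg (-P y))

end FacetTriangulation

namespace WGraph

variable {V E : Type*} {Γ : WGraph V E}

theorem StronglyConnected.sphereSeries_eq (h : Γ.StronglyConnected) (x₀ : V) :
    Γ.sphereSeries x₀ = genFun (Γ.natDist x₀) Set.univ := by
  ext i
  simp [sphereSeries, genFun, sphereCard, h.dist_eq]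

theorem StronglyConnected.ballCard_succ (h : Γ.StronglyConnected) {x₀ : V}
    (hfin : ∀ i, {y | Γ.natDist x₀ y ≤ i}.Finite) (i : ℕ) :
    Γ.ballCard x₀ (i + 1) = Γ.sphereCard x₀ (i + 1) + Γ.ballCard x₀ i := by
  have hball (i : ℕ) : Γ.ballCard x₀ i = {y | Γ.natDist x₀ y ≤ i}.ncard := by
    simp only [ballCard, h.dist_eq, Nat.cast_le]
  have hsphere : Γ.sphereCard x₀ (i + 1) = {y | Γ.natDist x₀ y = i + 1}.ncard := by
    simp only [sphereCard, h.dist_eq, Nat.cast_inj]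
  have hdisj : Disjoint {y | Γ.natDist x₀ y = i + 1} {y | Γ.natDist x₀ y ≤ i} :=
    Set.disjoint_left.2 fun y hy hy' => by
      rw [Set.mem_ofPred_eq] at hy hy'
      omega
  rw [hball, hball, hsphere, ← Set.ncard_union_eq hdisj ((hfin (i + 1)).subset fun y => le_of_eq)
    (hfin i)]
  congr 1
  ext y
  rw [Set.mem_union, Set.mem_ofPred_eq, Set.mem_ofPred_eq, Set.mem_ofPred_eq, Nat.le_succ_iff,
    or_comm]

theorem StronglyConnected.one_sub_X_mul_ballSeries (h : Γ.StronglyConnected) {x₀ : V}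
    (hfin : ∀ i, {y | Γ.natDist x₀ y ≤ i}.Finite) :
    (1 - PowerSeries.X) * Γ.ballSeries x₀ = Γ.sphereSeries x₀ := by
  ext i
  rw [sub_mul, one_mul, map_sub]
  cases i with
  | zero =>
    simp [ballSeries, sphereSeries, ballCard, sphereCard, h.dist_eq]
  | succ i =>
    rw [PowerSeries.coeff_succ_X_mul, sub_eq_iff_eq_add, ballSeries, sphereSeries]
    simp only [PowerSeries.coeff_mk]
    exact_mod_cast h.ballCard_succ hfin i

end WGraph

variable {L V E : Type*} [AddCommGroup L] [AddAction L V] [AddAction L E]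
  {Γ : PeriodicGraph L V E} {Φ : V → RealSpan L} {x₀ : V} {d : RealSpan L → ℕ}
  {T : Set (RealSpan L) → Finset (Finset (RealSpan L))} {Δ : Finset (RealSpan L)}

/-- The finite set of points whose convex hull is the growth polytope. -/
def generators (Γ : PeriodicGraph L V E) : Finset (RealSpan L) :=
  (Γ.finite_normalizedCycles.union (Set.finite_singleton 0)).toFinset

theorem coe_generators (Γ : PeriodicGraph L V E) :
    (generators Γ : Set (RealSpan L)) = Γ.normalizedCycles ∪ {0} := by
  simp [generators]

theorem convexHull_generators (Γ : PeriodicGraph L V E) :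
    convexHull ℝ (generators Γ : Set (RealSpan L)) = Γ.growthPolytope := by
  rw [coe_generators, PeriodicGraph.growthPolytope]

/-- The coordinates of a lattice vector with respect to a basis. -/
def latticeCoord {ι : Type*} [Finite ι] (b : Basis ι ℝ (RealSpan L)) : L →+ (ι → ℝ) :=
  b.equivFun.toLinearMap.toAddMonoidHom.comp (toRealHom L)

theorem latticeCoord_apply {ι : Type*} [Finite ι] (b : Basis ι ℝ (RealSpan L)) (u : L) :
    latticeCoord b u = b.equivFun (toReal u) := rfl

open FacetTriangulation

namespace IsArrangement

theorem facetTriangulation (h : IsArrangement Γ Φ x₀ d T) (hconn : Γ.StronglyConnected) :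
    FacetTriangulation (generators Γ) T where
  zero_mem := by simp [generators]
  hull_eq_top := by
    have : Nonempty V := ⟨x₀⟩
    rw [coe_generators, eq_top_iff, ← PeriodicGraph.hull_normalizedCycles hconn]
    exact Submodule.span_mono Set.subset_union_left
  triangulation := by
    rw [convexHull_generators]
    exact h.triangulation
  vertices := by
    rw [convexHull_generators]
    exact h.vertices

theorem pos_of_mem (h : IsArrangement Γ Φ x₀ d T) (hconn : Γ.StronglyConnected)
    (hΔ : Δ ∈ simplices (generators Γ) T) {v : RealSpan L} (hv : v ∈ Δ) : 0 < d v :=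
  h.pos v (convexHull_generators Γ ▸ (h.facetTriangulation hconn).subset_extremePoints hΔ hv)

theorem exists_toReal_eq (h : IsArrangement Γ Φ x₀ d T) (hconn : Γ.StronglyConnected)
    (hΔ : Δ ∈ simplices (generators Γ) T) {v : RealSpan L} (hv : v ∈ Δ) :
    ∃ u : L, toReal u = (d v : ℝ) • v :=
  h.integral v (convexHull_generators Γ ▸ (h.facetTriangulation hconn).subset_extremePoints hΔ hv)

theorem dotProduct_le_natDist (h : IsArrangement Γ Φ x₀ d T) (hconn : Γ.StronglyConnected)
    (hΔ : Δ ∈ simplices (generators Γ) T) {w : Δ → L}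
    (hw : ∀ v, toReal (w v) = (d v : ℝ) • (v : RealSpan L)) (k : Δ → ℕ) :
    k ⬝ᵥ (fun v => d v) ≤ Γ.natDist x₀ (Fintype.linearCombination ℕ w k +ᵥ x₀) := by
  obtain ⟨σ, hσ, hΔ⟩ := hΔ
  obtain ⟨l, hl, -, hlΔ⟩ := (h.facetTriangulation hconn).exists_normal hσ hΔ
  have hle := PeriodicGraph.map_toReal_le_natDist hconn l
    (fun a ha => hl a (Finset.mem_coe.1 (coe_generators Γ ▸ Or.inl ha))) x₀
    (Fintype.linearCombination ℕ w k)
  have hlw (v : Δ) : l (toReal (w v)) = d v := by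
    rw [hw, map_smul, hlΔ v v.2, smul_eq_mul, mul_one]
  simp only [Fintype.linearCombination_apply, toReal_sum, toReal_nsmul, map_sum, map_smul, hlw,
    smul_eq_mul] at hle
  exact_mod_cast hle

theorem natDist_add_natDist (h : IsArrangement Γ Φ x₀ d T) (hconn : Γ.StronglyConnected)
    (hΔ : Δ ∈ simplices (generators Γ) T) {w : Δ → L}
    (hw : ∀ v, toReal (w v) = (d v : ℝ) • (v : RealSpan L)) {s : Finset Δ} {y : V} {c : Δ → ℝ}
    (hc : ∀ v, 0 ≤ c v ∧ c v < d v) (hcs : ∀ v ∉ s, c v = 0)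
    (hy : Φ y - Φ x₀ = ∑ v, c v • (v : RealSpan L)) :
    Γ.natDist x₀ y + Γ.natDist y ((∑ v ∈ s, w v) +ᵥ x₀) = ∑ v ∈ s, d v := by
  classical
  obtain ⟨σ, hσ, hΔ⟩ := hΔ
  rw [convexHull_generators] at hσ
  have hbox := h.dist_add σ hσ Δ hΔ (s.map (Function.Embedding.subtype _))
    (Finset.map_subtype_subset s) (∑ v ∈ s, w v) (by simp [toReal_sum, hw]) y
    ⟨fun x => if hx : x ∈ Δ then c ⟨x, hx⟩ else 0, ?_, ?_⟩
  · rw [hconn.dist_eq, hconn.dist_eq, Finset.sum_map] at hbox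
    exact_mod_cast hbox
  · intro v hv
    obtain ⟨v', -, rfl⟩ := Finset.mem_map.1 hv
    simpa using hc v'
  · rw [hy, Finset.sum_map, ← Finset.sum_subset (Finset.subset_univ s) fun v _ hv => by
      rw [hcs v hv, zero_smul]]
    simp

theorem exists_isGeodesicCone (h : IsArrangement Γ Φ x₀ d T) (hconn : Γ.StronglyConnected)
    (hundir : Γ.Undirected) (hΦ : Γ.IsRealization Φ) [DecidableEq Δ]
    (hΔ : Δ ∈ simplices (generators Γ) T) :
    ∃ w : Δ → L, IsGeodesicCone Γ.natDist x₀
      (fun y => ((h.facetTriangulation hconn).basis hΔ).equivFun (Φ y - Φ x₀))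
      (latticeCoord ((h.facetTriangulation hconn).basis hΔ)) w fun v => d v := by
  set b := (h.facetTriangulation hconn).basis hΔ
  have hbv (v : Δ) : b v = v := basis_apply _ hΔ v
  choose w hw using fun v : Δ => h.exists_toReal_eq hconn hΔ v.2
  refine ⟨w, ?_⟩
  exact
    { self := WGraph.natDist_self x₀
      triangle := hconn.natDist_triangle
      comm := hconn.natDist_comm hundir
      vadd := PeriodicGraph.natDist_vadd hconn
      pos := fun v => h.pos_of_mem hconn hΔ v.2
      coord_base := by rw [sub_self, map_zero]
      coord_vadd := fun u y => by rw [hΦ, add_sub_assoc, map_add, latticeCoord_apply]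
      coord_generator := fun v => by
        have hone : b.equivFun (v : RealSpan L) = Pi.single v 1 := by
          ext i
          rw [← hbv v, b.equivFun_self, Pi.single_apply]
          simp only [eq_comm]
        rw [latticeCoord_apply, hw, map_smul, hone, ← Pi.single_smul, smul_eq_mul, mul_one]
      lower := h.dotProduct_le_natDist hconn hΔ hw
      box := fun s y hc hcs => h.natDist_add_natDist hconn hΔ hw hc hcs (by
        simpa only [hbv] using (b.sum_equivFun (Φ y - Φ x₀)).symm) }

theorem exists_isReciprocalSum [Module.Free ℤ L] [Module.Finite ℤ L]
    (h : IsArrangement Γ Φ x₀ d T) (hL : 0 < finrank ℤ L) (hconn : Γ.StronglyConnected)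
    (hundir : Γ.Undirected) (hΦ : Γ.IsRealization Φ) [Fintype (simplices (generators Γ) T)] :
    ∃ N, IsReciprocalSum (Γ.sphereSeries x₀) (finrank ℤ L)
      (fun Δ : simplices (generators Γ) T => ∏ v : Δ.1, (1 - Polynomial.X ^ d v)) N := by
  classical
  have hF := h.facetTriangulation hconn
  have hrank : finrank ℝ (RealSpan L) = finrank ℤ L := finrank_baseChange
  have : Nontrivial (RealSpan L) := nontrivial_of_finrank_pos (hrank ▸ hL)
  have hball := PeriodicGraph.finite_ball hconn x₀
  have hsphere (m : ℕ) : {y | Γ.natDist x₀ y = m}.Finite := (hball m).subset fun y => le_of_eq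
  have hpos (Δ : simplices (generators Γ) T) : ∀ v ∈ (Finset.univ : Finset Δ.1), 0 < d v :=
    fun v _ => h.pos_of_mem hconn Δ.2 v.2
  obtain ⟨ξ, hξ⟩ := exists_generic (generators Γ).finite_toSet
  choose w hcone using fun Δ : simplices (generators Γ) T =>
    h.exists_isGeodesicCone hconn hundir hΦ Δ.2
  choose N hdeg hN hN' using fun Δ : simplices (generators Γ) T =>
    (hcone Δ).exists_numerator hball fun v => 0 < (hF.basis Δ.2).repr ξ v
  refine ⟨N, fun Δ => prod_one_sub_X_pow_ne_zero (hpos Δ), fun Δ => ?_, fun Δ => ?_, ?_, ?_⟩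
  · rw [reverse_prod_one_sub_X_pow, Finset.card_univ, Fintype.card_coe, hF.card_eq Δ.2, hrank]
  · rw [natDegree_prod_one_sub_X_pow (hpos Δ)]
    exact hdeg Δ
  · rw [hconn.sphereSeries_eq,
      hF.genFun_univ_eq_sum hξ hsphere fun y => Φ y - Φ x₀]
    refine IsExpansion.sum fun Δ _ =>
      (isExpansion_div_iff (prod_one_sub_X_pow_ne_zero (hpos Δ)) (isExpansion_algebraMap _)).2 ?_
    rw [coe_prod_one_sub_X_pow]
    exact hN Δ
  · rw [hconn.sphereSeries_eq,
      hF.genFun_univ_eq_sum_neg hξ hsphere fun y => Φ y - Φ x₀]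
    refine IsExpansion.sum fun Δ _ =>
      (isExpansion_div_iff (prod_one_sub_X_pow_ne_zero (hpos Δ)) (isExpansion_algebraMap _)).2 ?_
    rw [coe_prod_one_sub_X_pow, natDegree_prod_one_sub_X_pow (hpos Δ)]
    exact hN' Δ

theorem exists_forall_dvd [Module.Free ℤ L] [Module.Finite ℤ L] (h : IsArrangement Γ Φ x₀ d T)
    (hconn : Γ.StronglyConnected) : ∃ K : ℕ, 0 < K ∧ ∀ Δ : simplices (generators Γ) T,
      ∏ v : Δ.1, (1 - Polynomial.X ^ d v) ∣ ((1 - Polynomial.X ^ K) ^ finrank ℤ L : ℚ[X]) := by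
  have hF := h.facetTriangulation hconn
  have hfin : (⋃ Δ ∈ simplices (generators Γ) T, (Δ : Set (RealSpan L))).Finite :=
    hF.finite_simplices.biUnion fun Δ _ => Δ.finite_toSet
  refine ⟨∏ v ∈ hfin.toFinset, d v, Finset.prod_pos fun v hv => ?_, fun Δ => ?_⟩
  · obtain ⟨Δ, hΔ, hv⟩ := Set.mem_iUnion₂.1 (hfin.mem_toFinset.1 hv)
    exact h.pos_of_mem hconn hΔ hv
  · have hcard : (Finset.univ : Finset Δ.1).card = finrank ℤ L := by
      rw [Finset.card_univ, Fintype.card_coe, hF.card_eq Δ.2]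
      exact finrank_baseChange
    rw [← hcard]
    exact prod_one_sub_X_pow_dvd fun v _ => Finset.dvd_prod_of_mem _
      (hfin.mem_toFinset.2 (Set.mem_biUnion Δ.2 v.2))

end IsArrangement

theorem range_prod_eq_simplexPolynomials (Γ : PeriodicGraph L V E) (d : RealSpan L → ℕ)
    (T : Set (RealSpan L) → Finset (Finset (RealSpan L))) :
    Set.range (fun Δ : simplices (generators Γ) T => ∏ v : Δ.1, (1 - Polynomial.X ^ d v)) =
      simplexPolynomials Γ d T := by
  ext f
  constructor
  · rintro ⟨⟨Δ, σ, hσ, hΔ⟩, rfl⟩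
    exact ⟨σ, convexHull_generators Γ ▸ hσ, Δ, hΔ, Finset.prod_coe_sort Δ fun v => 1 - _ ^ d v⟩
  · rintro ⟨σ, hσ, Δ, hΔ, rfl⟩
    exact ⟨⟨Δ, σ, (convexHull_generators Γ).symm ▸ hσ, hΔ⟩,
      Finset.prod_coe_sort Δ fun v => 1 - _ ^ d v⟩

end Growth

end PeriodicGrowth

end

theorem theorem5p8 {L V E : Type*} [AddCommGroup L] [Module.Free ℤ L] [Module.Finite ℤ L]
    [AddAction L V] [AddAction L E] (n : ℕ) (hn : 0 < n) (hL : Module.finrank ℤ L = n)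
    (Γ : PeriodicGraph L V E) (hconn : Γ.StronglyConnected) (hundir : Γ.Undirected)
    (Φ : V → RealSpan L) (hΦ : Γ.IsRealization Φ) (x₀ : V) (hWA : WellArranged Γ Φ x₀) :
    -- the cumulative growth sequence is a quasi-polynomial on `i ≥ 0`
    IsQuasiPolynomialOn (Γ.ballCard x₀) 0 ∧
    -- the form of the growth series, for all `d_v` and `T_σ` as in the definition
    (∀ d T, IsArrangement Γ Φ x₀ d T →
      ∃ Q₁ Q₂ : Polynomial ℚ, IsLCM (simplexPolynomials Γ d T) Q₂ ∧ Q₁.degree ≤ Q₂.degree ∧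
        IsExpansion (algebraMap (Polynomial ℚ) (RatFunc ℚ) Q₁ /
          algebraMap (Polynomial ℚ) (RatFunc ℚ) Q₂) (Γ.sphereSeries x₀)) ∧
    -- the reciprocity laws for the generating functions
    (∃ Gb Gs : RatFunc ℚ,
      IsExpansion Gb (Γ.ballSeries x₀) ∧ IsExpansion Gs (Γ.sphereSeries x₀) ∧
      atInv Gb = (-1) ^ (n + 1) * RatFunc.X * Gb ∧ atInv Gs = (-1) ^ n * Gs) ∧
    -- the reciprocity laws for the corresponding quasi-polynomials
    (∀ fb, IsQuasiPolynomialOf fb (Γ.ballCard x₀) →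
      ∀ i : ℤ, fb (-i) = (-1) ^ n * fb (i - 1)) ∧
    IsQuasiPolynomialOn (Γ.sphereCard x₀) 1 ∧
    (∀ fs, IsQuasiPolynomialOf fs (Γ.sphereCard x₀) →
      ∀ i : ℤ, i ≠ 0 → fs (-i) = (-1) ^ (n + 1) * fs i) := by
  subst hL
  obtain ⟨d, T, hA⟩ := hWA
  have := (hA.facetTriangulation hconn).finite_simplices.fintype
  obtain ⟨N, hrec⟩ := hA.exists_isReciprocalSum hn hconn hundir hΦ
  obtain ⟨K, hK, hQK⟩ := hA.exists_forall_dvd hconn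
  have hb := hconn.one_sub_X_mul_ballSeries (PeriodicGraph.finite_ball hconn x₀)
  obtain ⟨fb, hfb, hfb_eq, hfb_neg⟩ := hrec.exists_isQuasiPolynomial_cumulative hb hK hQK
  obtain ⟨fs, hfs, hfs_eq, hfs_neg⟩ := hrec.exists_isQuasiPolynomial hb rfl hK hQK
  refine ⟨⟨fb, hfb, fun i _ => hfb_eq i⟩, fun d T hA => ?_, hrec.exists_ratFunc hb,
    fun f hf i => ?_, ⟨fs, hfs, hfs_eq⟩, fun f hf i _ => ?_⟩
  · have := (hA.facetTriangulation hconn).finite_simplices.fintype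
    obtain ⟨N, hrec⟩ := hA.exists_isReciprocalSum hn hconn hundir hΦ
    exact range_prod_eq_simplexPolynomials Γ d T ▸ hrec.exists_isLCM
  · rw [hf.unique ⟨hfb, 0, fun i _ => hfb_eq i⟩]
    exact hfb_neg i
  · rw [hf.unique ⟨hfs, 0, fun i hi => hfs_eq i hi⟩]
    exact hfs_neg i
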